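/- Let $H\in(0,\frac12)$, $M<2$, $\gamma\in(0,1]$, $d\in\mathbb N$. Let $W=\{W(t,x):t\in\mathbb R,\ x\in\mathbb R^d\}$ be a (jointly measurable) mean-zero Gaussian random field on a probability space $(\Omega,\mathcal F,P)$ with covariance $$E\big(W(t,x)W(s,y)\big)=\tfrac12\big(|t|^{2H}+|s|^{2H}-|t-s|^{2H}\big)\,Q(x,y),$$ where $Q:\mathbb R^d\times\mathbb R^d\to\mathbb R$ satisfies, for some constants $C_0,C_1>0$ and every $K>0$, (Q1) $Q(x,y)\le C_0(1+K)^M$ whenever $|x|,|y|\le K$; (Q2) $|Q(x,y)-Q(u,v)|\le C_1(1+K)^M\big(|x-u|^\gamma+|y-v|^\gamma\big)$ whenever $|x|,|y|,|u|,|v|\le K$. For a continuous $\phi:[0,T]\to\mathbb R^d$ and $0\le t\le T$, define $$\int_0^tW(ds,\phi_s)=\lim_{\varepsilon\downarrow0}\int_0^t\frac{W(s+\varepsilon,\phi_s)-W(s-\varepsilon,\phi_s)}{2\varepsilon}\,ds,$$ if the limit exists in $L^2(\Omega)$. **Proposition.** Let $0\le t\le T$ and let $\phi,\psi:[0,T]\to\mathbb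 R^d$ be Hölder continuous of order $\alpha$, where $\alpha\gamma>1-2H$. Then the integrals $\int_0^tW(dr,\phi_r)$ and $\int_0^tW(dr,\psi_r)$ exist, the deterministic integrals below converge absolutely, and $$\begin{aligned}E\Big(\int_0^tW(dr,\phi_r)\int_0^tW(dr,\psi_r)\Big)={}&2H\int_0^t\theta^{2H-1}Q(\phi_\theta,\psi_\theta)\,d\theta\\&+H(2H-1)\int_0^t\int_0^\theta r^{2H-2}\big(Q(\phi_\theta,\psi_{\theta-r})-Q(\phi_\theta,\psi_\theta)\big)\,dr\,d\theta\\&+H(2H-1)\int_0^t\int_0^\theta r^{2H-2}\big(Q(\phi_{\theta-r},\psi_\theta)-Q(\phi_\theta,\psi_\theta)\big)\,dr\,d\theta.\end{aligned}$$ -/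

import Mathlib

open MeasureTheory ProbabilityTheory Filter Topology Set
open scoped NNReal ENNReal

namespace NonlinearFBM

/-- Covariance function of the two-sided fractional Brownian motion of Hurst parameter `H`. -/
noncomputable def fbmCov (H t s : ℝ) : ℝ :=
  (1 / 2) * (|t| ^ (2 * H) + |s| ^ (2 * H) - |t - s| ^ (2 * H))

/-- `W = {W(t,x) : t ∈ ℝ, x ∈ ℝ^d}` is a (jointly measurable) centered Gaussian random field on
`(Ω, P)`, fractional of Hurst parameter `H` in time and with spatial covariance `Q`.
Joint measurability makes the pathwise time integrals of `W` meaningful. -/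
structure IsFractionalField {Ω : Type*} [MeasurableSpace Ω] {d : ℕ} (P : Measure Ω)
    (W : ℝ → EuclideanSpace ℝ (Fin d) → Ω → ℝ) (H : ℝ)
    (Q : EuclideanSpace ℝ (Fin d) → EuclideanSpace ℝ (Fin d) → ℝ) : Prop where
  measurable : Measurable
    (fun p : (ℝ × EuclideanSpace ℝ (Fin d)) × Ω => W p.1.1 p.1.2 p.2)
  gaussian : IsGaussianProcess
    (fun (p : ℝ × EuclideanSpace ℝ (Fin d)) (ω : Ω) => W p.1 p.2 ω) P
  mean_zero : ∀ t x, ∫ ω, W t x ω ∂P = 0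
  covariance : ∀ t x s y, ∫ ω, W t x ω * W s y ω ∂P = fbmCov H t s * Q x y

/-- Local boundedness of the spatial covariance, with growth exponent `M`. -/
def LocallyBoundedCov {d : ℕ} (M : ℝ)
    (Q : EuclideanSpace ℝ (Fin d) → EuclideanSpace ℝ (Fin d) → ℝ) : Prop :=
  ∃ C₀ : ℝ, 0 < C₀ ∧ ∀ K : ℝ, 0 < K → ∀ x y, ‖x‖ ≤ K → ‖y‖ ≤ K →
    Q x y ≤ C₀ * (1 + K) ^ M

/-- Local `γ`-Hölder continuity of the spatial covariance, with growth exponent `M`. -/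
def LocallyHolderCov {d : ℕ} (M γ : ℝ)
    (Q : EuclideanSpace ℝ (Fin d) → EuclideanSpace ℝ (Fin d) → ℝ) : Prop :=
  ∃ C₁ : ℝ, 0 < C₁ ∧ ∀ K : ℝ, 0 < K → ∀ x y u v, ‖x‖ ≤ K → ‖y‖ ≤ K → ‖u‖ ≤ K → ‖v‖ ≤ K →
    |Q x y - Q u v| ≤ C₁ * (1 + K) ^ M * (‖x - u‖ ^ γ + ‖y - v‖ ^ γ)

/-- The symmetric difference quotient of `W` in time,
`(W(s+ε,x) - W(s-ε,x)) / (2ε)`. -/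
noncomputable def Wdot {Ω : Type*} {d : ℕ} (W : ℝ → EuclideanSpace ℝ (Fin d) → Ω → ℝ)
    (ε s : ℝ) (x : EuclideanSpace ℝ (Fin d)) (ω : Ω) : ℝ :=
  (1 / (2 * ε)) * (W (s + ε) x ω - W (s - ε) x ω)

/-- The approximating integral of the difference quotient along `φ` over `[0,t]`. -/
noncomputable def approxIntegral {Ω : Type*} {d : ℕ} (W : ℝ → EuclideanSpace ℝ (Fin d) → Ω → ℝ)
    (φ : ℝ → EuclideanSpace ℝ (Fin d)) (t ε : ℝ) (ω : Ω) : ℝ :=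
  ∫ s in (0 : ℝ)..t, Wdot W ε s (φ s) ω

/-- `I` is (a version of) the nonlinear stochastic integral `∫₀ᵗ W(ds, φ_s)`: the limit in
`L²(Ω)` of the approximating integrals as `ε ↓ 0`. -/
def IsNonlinearIntegral {Ω : Type*} [MeasurableSpace Ω] {d : ℕ} (P : Measure Ω)
    (W : ℝ → EuclideanSpace ℝ (Fin d) → Ω → ℝ) (φ : ℝ → EuclideanSpace ℝ (Fin d)) (t : ℝ)
    (I : Ω → ℝ) : Prop :=
  MemLp I 2 P ∧ (∀ ε : ℝ, 0 < ε → MemLp (approxIntegral W φ t ε) 2 P) ∧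
    Tendsto (fun ε : ℝ => eLpNorm (fun ω => approxIntegral W φ t ε ω - I ω) 2 P)
      (𝓝[>] 0) (𝓝 0)

/-- `φ` is Hölder continuous of order `α` on `[0,T]`. -/
def IsHolderPath {d : ℕ} (α : ℝ≥0) (T : ℝ) (φ : ℝ → EuclideanSpace ℝ (Fin d)) : Prop :=
  ∃ C : ℝ≥0, HolderOnWith C α φ (Icc 0 T)

/-- The triangle `{(θ, r) : 0 < r ≤ θ ≤ t}`. -/
def triangle (t : ℝ) : Set (ℝ × ℝ) := {p | 0 < p.2 ∧ p.2 ≤ p.1 ∧ p.1 ≤ t}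

end NonlinearFBM

/-! The product of two approximating integrals with steps `ε`, `ε'` has expectation `∫∫ V(s - r)
Q(φ_s, ψ_r) dr ds` over `[0,t]²`, where `V = fbmKernel H ε ε'` is half a mixed second difference of
`|u|^(2H)`. As the steps vanish, `V(u)` tends to `H(2H-1)|u|^(2H-2)`, which is not integrable at
`0`. Fold the square onto the triangle `0 < r ≤ θ ≤ t` (later time `θ`, gap `r`) and subtract the
diagonal value of `Q`. The increment is `O(r^(αγ))`, and `αγ > 1 - 2H` restores integrability: this
gives the two correction terms. The diagonal value is multiplied by `∫₀^θ V`, half a mixed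
difference of the odd primitive of `|x|^(2H)`; it tends to `H θ^(2H-1)`, and the two triangles give
the factor `2H`.

The passage to the limit needs bounds uniform in the steps. For `r ≥ 2(ε + ε')` the mean value
theorem gives `|V(r)| ≤ 4 r^(2H-2)` (`abs_fbmKernel_le`). For smaller `r` there is an `L¹` bound of
order `(ε + ε')^(2H-1)` (`integral_abs_fbmKernel_le`), and the factor `r^(αγ)` makes this part
vanish. Dominated convergence then yields `tendsto_integral_square_fbmKernel_mul`.

The limit is joint in independent `ε` and `ε'`. For `φ = ψ` it says that the approximations are
Cauchy in `L²`, so the integral exists; for two paths, its restriction to `ε = ε'` is the covariance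
formula. -/

namespace NonlinearFBM

/-! ### Mixed second differences -/

/-- The mixed second-order symmetric difference quotient of `f` with steps `e` and `e'`. -/
noncomputable def mixedDiffQuot (f : ℝ → ℝ) (e e' x : ℝ) : ℝ :=
  (f (x + e + e') - f (x + e - e') - f (x - e + e') + f (x - e - e')) / (4 * e * e')

theorem mixedDiffQuot_comm (f : ℝ → ℝ) (e e' x : ℝ) :
    mixedDiffQuot f e e' x = mixedDiffQuot f e' e x := by
  unfold mixedDiffQuot
  rw [show x + e + e' = x + e' + e by ring, show x + e - e' = x - e' + e by ring,
    show x - e + e' = x + e' - e by ring, show x - e - e' = x - e' - e by ring]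
  ring

/-- Mean value theorem twice: for `y ↦ f (y + e') - f (y - e')`, then for `f'`. Derivatives are
asked only to the right of `x - (e + e')`, so that functions singular at `0` are allowed. -/
theorem exists_mixedDiffQuot_eq {f f' f'' : ℝ → ℝ} {x e e' : ℝ} (he : 0 < e) (he' : 0 < e')
    (hf : ∀ y, x - (e + e') ≤ y → HasDerivAt f (f' y) y)
    (hf' : ∀ y, x - (e + e') ≤ y → HasDerivAt f' (f'' y) y) :
    ∃ ξ ∈ Ioo (x - (e + e')) (x + (e + e')), mixedDiffQuot f e e' x = f'' ξ := by
  have hg : ∀ y, x - e ≤ y →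
      HasDerivAt (fun y => f (y + e') - f (y - e')) (f' (y + e') - f' (y - e')) y := fun y hy =>
    ((hf (y + e') (by linarith)).comp_add_const y e').sub
      ((hf (y - e') (by linarith)).comp_sub_const y e')
  obtain ⟨c, hc, hc'⟩ := exists_hasDerivAt_eq_slope (fun y => f (y + e') - f (y - e'))
    (fun y => f' (y + e') - f' (y - e')) (show x - e < x + e by linarith)
    (fun y hy => (hg y hy.1).continuousAt.continuousWithinAt) (fun y hy => hg y hy.1.le)
  obtain ⟨ξ, hξ, hξ'⟩ := exists_hasDerivAt_eq_slope f' f'' (show c - e' < c + e' by linarith)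
    (fun y hy => (hf' y (by linarith [hy.1, hc.1])).continuousAt.continuousWithinAt)
    (fun y hy => hf' y (by linarith [hy.1, hc.1]))
  refine ⟨ξ, ⟨by linarith [hξ.1, hc.1], by linarith [hξ.2, hc.2]⟩, ?_⟩
  rw [hξ', hc']
  unfold mixedDiffQuot
  rw [show x + e - (x - e) = 2 * e by ring, show c + e' - (c - e') = 2 * e' by ring]
  field_simp
  ring

theorem tendsto_mixedDiffQuot {f f' f'' : ℝ → ℝ} {x : ℝ} (hx : 0 < x)
    (hf : ∀ y, 0 < y → HasDerivAt f (f' y) y) (hf' : ∀ y, 0 < y → HasDerivAt f' (f'' y) y)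
    (hc : ContinuousAt f'' x) :
    Tendsto (fun p : ℝ × ℝ => mixedDiffQuot f p.1 p.2 x) (𝓝[>] 0 ×ˢ 𝓝[>] 0) (𝓝 (f'' x)) := by
  rw [Metric.tendsto_nhds]
  intro η hη
  obtain ⟨δ, hδ, hδ'⟩ := Metric.continuousAt_iff.1 hc η hη
  -- With both steps below this, `e + e'` is less than `x`, which keeps the stencil in the positive
  -- axis, and less than `δ`.
  have hm : 0 < min x δ / 2 := by positivity
  have h1 : ∀ᶠ e : ℝ in 𝓝[>] 0, e ∈ Ioo 0 (min x δ / 2) := Ioo_mem_nhdsGT hm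
  filter_upwards [h1.prod_mk h1] with p hp
  obtain ⟨hp1, hp2⟩ := hp
  have hx' : min x δ ≤ x := min_le_left _ _
  have hδ2 : min x δ ≤ δ := min_le_right _ _
  obtain ⟨ξ, hξ, h⟩ := exists_mixedDiffQuot_eq (x := x) hp1.1 hp2.1
    (fun y hy => hf y (by linarith [hp1.2, hp2.2])) (fun y hy => hf' y (by linarith [hp1.2, hp2.2]))
  rw [h]
  refine hδ' ?_
  rw [Real.dist_eq, abs_lt]
  constructor <;> linarith [hξ.1, hξ.2, hp1.2, hp2.2]

/-! ### The covariance kernel and its bounds near and away from the diagonal -/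

/-- The time covariance of two symmetric difference quotients, with steps `e` and `e'`, of a
fractional Brownian motion at times with difference `u`. -/
noncomputable def fbmKernel (H e e' u : ℝ) : ℝ :=
  (1 / 2) * mixedDiffQuot (fun x => |x| ^ (2 * H)) e e' u

theorem fbmKernel_comm (H e e' u : ℝ) : fbmKernel H e e' u = fbmKernel H e' e u := by
  unfold fbmKernel; rw [mixedDiffQuot_comm]

theorem fbmKernel_neg (H e e' u : ℝ) : fbmKernel H e e' (-u) = fbmKernel H e e' u := by
  unfold fbmKernel mixedDiffQuot
  rw [show -u + e + e' = -(u - e - e') by ring, show -u + e - e' = -(u - e + e') by ring,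
    show -u - e + e' = -(u + e - e') by ring, show -u - e - e' = -(u + e + e') by ring]
  simp only [abs_neg]
  ring

theorem continuous_abs_rpow {p : ℝ} (hp : 0 ≤ p) : Continuous fun x : ℝ => |x| ^ p :=
  continuous_abs.rpow_const fun _ => Or.inr hp

theorem continuous_fbmKernel {H : ℝ} (hH : 0 < H) (e e' : ℝ) : Continuous (fbmKernel H e e') := by
  have h := continuous_abs_rpow (show 0 ≤ 2 * H by positivity)
  unfold fbmKernel mixedDiffQuot
  refine continuous_const.mul (Continuous.div_const ?_ _)
  exact (((h.comp (by fun_prop : Continuous fun u : ℝ => u + e + e')).sub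
    (h.comp (by fun_prop : Continuous fun u : ℝ => u + e - e'))).sub
    (h.comp (by fun_prop : Continuous fun u : ℝ => u - e + e'))).add
    (h.comp (by fun_prop : Continuous fun u : ℝ => u - e - e'))

theorem hasDerivAt_abs_rpow {p y : ℝ} (hy : 0 < y) :
    HasDerivAt (fun x : ℝ => |x| ^ p) (p * y ^ (p - 1)) y := by
  refine (Real.hasDerivAt_rpow_const (Or.inl hy.ne')).congr_of_eventuallyEq ?_
  filter_upwards [lt_mem_nhds hy] with z hz
  rw [abs_of_pos hz]

theorem hasDerivAt_const_mul_rpow {p y : ℝ} (hy : 0 < y) :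
    HasDerivAt (fun x : ℝ => p * x ^ (p - 1)) (p * (p - 1) * y ^ (p - 2)) y := by
  have := (Real.hasDerivAt_rpow_const (x := y) (p := p - 1) (Or.inl hy.ne')).const_mul p
  rwa [show p - 1 - 1 = p - 2 by ring, ← mul_assoc] at this

theorem tendsto_fbmKernel (H : ℝ) {r : ℝ} (hr : 0 < r) :
    Tendsto (fun p : ℝ × ℝ => fbmKernel H p.1 p.2 r) (𝓝[>] 0 ×ˢ 𝓝[>] 0)
      (𝓝 (H * (2 * H - 1) * r ^ (2 * H - 2))) := by
  have h := (tendsto_mixedDiffQuot (f := fun x => |x| ^ (2 * H)) hr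
    (fun y hy => hasDerivAt_abs_rpow hy) (fun y hy => hasDerivAt_const_mul_rpow hy)
    (continuousAt_const.mul (Real.continuousAt_rpow_const _ _ (Or.inl hr.ne')))).const_mul (1 / 2)
  rwa [show 1 / 2 * (2 * H * (2 * H - 1) * r ^ (2 * H - 2)) =
    H * (2 * H - 1) * r ^ (2 * H - 2) by ring] at h

/-- Away from the diagonal the intermediate point is at least `r / 2`; the constant `4` absorbs
`2^(2 - 2H)`. -/
theorem abs_fbmKernel_le {H e e' r : ℝ} (hH : 0 < H) (hH' : H < 1 / 2) (he : 0 < e) (he' : 0 < e')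
    (hr : 2 * (e + e') ≤ r) : |fbmKernel H e e' r| ≤ 4 * r ^ (2 * H - 2) := by
  have hr0 : 0 < r := by linarith
  obtain ⟨ξ, hξ, h⟩ := exists_mixedDiffQuot_eq (f := fun x => |x| ^ (2 * H)) (x := r) he he'
    (fun y hy => hasDerivAt_abs_rpow (by linarith))
    (fun y hy => hasDerivAt_const_mul_rpow (by linarith))
  have h2 : r / 2 ≤ ξ := by linarith [hξ.1]
  have h3 : ξ ^ (2 * H - 2) ≤ (r / 2) ^ (2 * H - 2) :=
    Real.rpow_le_rpow_of_nonpos (by positivity) h2 (by linarith)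
  have h4 : (r / 2) ^ (2 * H - 2) ≤ 4 * r ^ (2 * H - 2) := by
    rw [Real.div_rpow hr0.le zero_le_two, div_eq_mul_inv, ← Real.rpow_neg zero_le_two, mul_comm]
    gcongr
    calc (2 : ℝ) ^ (-(2 * H - 2)) ≤ (2 : ℝ) ^ (2 : ℝ) :=
          Real.rpow_le_rpow_of_exponent_le one_le_two (by linarith)
      _ = 4 := by norm_num
  have h5 : 0 ≤ ξ ^ (2 * H - 2) := Real.rpow_nonneg (by linarith) _
  have h6 : |H * (2 * H - 1)| ≤ 1 := by rw [abs_le]; constructor <;> nlinarith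
  unfold fbmKernel
  rw [h, show 1 / 2 * (2 * H * (2 * H - 1) * ξ ^ (2 * H - 2)) = H * (2 * H - 1) * ξ ^ (2 * H - 2)
    by ring, abs_mul, abs_of_nonneg h5]
  nlinarith

/-- On `[0, L]` the difference is nonnegative, so its integral telescopes to that of `|v|^p` over
`[L - h, L + h]` minus that over `[-h, h]`; the latter is dropped. Evenness doubles the bound. The
gain is the linear factor `h`. -/
theorem integral_abs_sub_le {p L h : ℝ} (hp : 0 ≤ p) (hL : 0 ≤ L) (hh : 0 ≤ h) :
    ∫ v in (-L)..L, |(|v + h| ^ p - |v - h| ^ p)| ≤ 4 * h * (L + h) ^ p := by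
  have hc := continuous_abs_rpow hp
  have hc1 : Continuous fun v : ℝ => |v + h| ^ p := hc.comp (continuous_add_const h)
  have hc2 : Continuous fun v : ℝ => |v - h| ^ p := hc.comp (continuous_id.sub continuous_const)
  have hi : ∀ a b, IntervalIntegrable (fun v : ℝ => |v| ^ p) volume a b := fun a b =>
    hc.intervalIntegrable a b
  have hg : Continuous fun v : ℝ => |(|v + h| ^ p - |v - h| ^ p)| := (hc1.sub hc2).abs
  have key : ∫ v in (0 : ℝ)..L, |(|v + h| ^ p - |v - h| ^ p)| ≤ 2 * h * (L + h) ^ p := by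
    have h1 : ∫ v in (0 : ℝ)..L, |(|v + h| ^ p - |v - h| ^ p)| =
        ∫ v in (0 : ℝ)..L, (|v + h| ^ p - |v - h| ^ p) := by
      refine intervalIntegral.integral_congr fun v hv => ?_
      rw [uIcc_of_le hL] at hv
      refine abs_of_nonneg (sub_nonneg.2 (Real.rpow_le_rpow (abs_nonneg _) ?_ hp))
      rw [abs_of_nonneg (by linarith [hv.1] : 0 ≤ v + h), abs_le]
      constructor <;> linarith [hv.1]
    have h2 : ∫ v in (-h)..h, |v| ^ p ≥ 0 :=
      intervalIntegral.integral_nonneg (by linarith) fun v _ => by positivity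
    have h3 : ∫ v in (L - h)..(L + h), |v| ^ p ≤ ∫ v in (L - h)..(L + h), (L + h) ^ p := by
      refine intervalIntegral.integral_mono_on (by linarith) (hi _ _) (by simp) fun v hv => ?_
      refine Real.rpow_le_rpow (abs_nonneg _) ?_ hp
      rw [abs_le]; constructor <;> linarith [hv.1, hv.2]
    rw [h1, intervalIntegral.integral_sub (hc1.intervalIntegrable _ _)
      (hc2.intervalIntegrable _ _),
      intervalIntegral.integral_comp_add_right (fun v => |v| ^ p),
      intervalIntegral.integral_comp_sub_right (fun v => |v| ^ p), zero_add, zero_sub]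
    rw [intervalIntegral.integral_const, smul_eq_mul] at h3
    have h4 := intervalIntegral.integral_add_adjacent_intervals (hi (-h) (L - h))
      (hi (L - h) (L + h))
    have h5 := intervalIntegral.integral_add_adjacent_intervals (hi (-h) h) (hi h (L + h))
    nlinarith
  have heven : ∫ v in (-L)..0, |(|v + h| ^ p - |v - h| ^ p)| =
      ∫ v in (0 : ℝ)..L, |(|v + h| ^ p - |v - h| ^ p)| := by
    have := intervalIntegral.integral_comp_neg (a := 0) (b := L)
      (fun v => |(|v + h| ^ p - |v - h| ^ p)|)
    rw [neg_zero] at this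
    rw [← this]
    refine intervalIntegral.integral_congr fun v _ => ?_
    rw [show -v + h = -(v - h) by ring, show -v - h = -(v + h) by ring, abs_neg, abs_neg,
      abs_sub_comm]
  rw [← intervalIntegral.integral_add_adjacent_intervals (hg.intervalIntegrable (-L) 0)
    (hg.intervalIntegrable 0 L), heven]
  linarith

/-- The kernel is a difference of two first differences with the smaller step `e'`. Their `L¹` norm
is linear in `e'`, which cancels `e'` in the denominator; the remaining `1 / e` is at most `2 / (e +
e')` because `e` is the larger step. -/
theorem integral_abs_fbmKernel_le_of_le {H e e' : ℝ} (hH : 0 < H) (hH' : H < 1 / 2)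
    (he' : 0 < e') (hee : e' ≤ e) :
    ∫ r in (0 : ℝ)..2 * (e + e'), |fbmKernel H e e' r| ≤ 8 * (e + e') ^ (2 * H - 1) := by
  have he : 0 < e := he'.trans_le hee
  set δ := e + e' with hδ
  have hδ0 : 0 < δ := by positivity
  have hp : 0 ≤ 2 * H := by positivity
  have hc := continuous_abs_rpow hp
  let g : ℝ → ℝ := fun v => |(|v + e'| ^ (2 * H) - |v - e'| ^ (2 * H))|
  have hg : Continuous g := ((hc.comp (continuous_add_const e')).sub
    (hc.comp (continuous_id.sub continuous_const))).abs
  have hg0 : ∀ v, 0 ≤ g v := fun v => abs_nonneg _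
  -- `3δ` contains all shifts `r ± e` with `0 ≤ r ≤ 2δ`.
  have hB := integral_abs_sub_le (L := 3 * δ) hp (by positivity) he'.le
  have hsub : ∀ a b, -(3 * δ) ≤ a → a ≤ b → b ≤ 3 * δ →
      ∫ v in a..b, g v ≤ ∫ v in (-(3 * δ))..3 * δ, g v := fun a b ha hab hb =>
    intervalIntegral.integral_mono_interval ha hab hb (ae_of_all _ hg0)
      (hg.intervalIntegrable _ _)
  have h1 : ∀ r, |fbmKernel H e e' r| ≤ 1 / (8 * e * e') * (g (r + e) + g (r - e)) := by
    intro r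
    have : fbmKernel H e e' r = 1 / (8 * e * e') *
        ((|r + e + e'| ^ (2 * H) - |r + e - e'| ^ (2 * H)) -
          (|r - e + e'| ^ (2 * H) - |r - e - e'| ^ (2 * H))) := by
      unfold fbmKernel mixedDiffQuot; field_simp; ring
    rw [this, abs_mul, abs_of_pos (by positivity : 0 < 1 / (8 * e * e'))]
    gcongr
    exact abs_sub _ _
  have hc1 : Continuous fun r => g (r + e) := hg.comp (continuous_add_const e)
  have hc2 : Continuous fun r => g (r - e) := hg.comp (continuous_id.sub continuous_const)
  have h2 : ∫ r in (0 : ℝ)..2 * δ, |fbmKernel H e e' r| ≤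
      1 / (8 * e * e') * (2 * ∫ v in (-(3 * δ))..3 * δ, g v) := by
    calc _ ≤ ∫ r in (0 : ℝ)..2 * δ, 1 / (8 * e * e') * (g (r + e) + g (r - e)) :=
          intervalIntegral.integral_mono_on (by positivity)
            ((continuous_fbmKernel hH e e').abs.intervalIntegrable _ _)
            ((continuous_const.mul (hc1.add hc2)).intervalIntegrable _ _) fun r _ => h1 r
      _ = 1 / (8 * e * e') * ((∫ v in (0 + e)..(2 * δ + e), g v) +
            ∫ v in (0 - e)..(2 * δ - e), g v) := by
          rw [intervalIntegral.integral_const_mul, intervalIntegral.integral_add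
            (hc1.intervalIntegrable _ _) (hc2.intervalIntegrable _ _),
            intervalIntegral.integral_comp_add_right g, intervalIntegral.integral_comp_sub_right g]
      _ ≤ _ := by
          rw [two_mul (∫ v in (-(3 * δ))..3 * δ, g v)]
          gcongr
          · exact hsub _ _ (by linarith) (by linarith) (by linarith)
          · exact hsub _ _ (by linarith) (by linarith) (by linarith)
  have h4 : (3 * δ + e') ^ (2 * H) ≤ 4 * δ ^ (2 * H) := by
    calc (3 * δ + e') ^ (2 * H) ≤ (4 * δ) ^ (2 * H) :=
          Real.rpow_le_rpow (by positivity) (by linarith) hp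
      _ = 4 ^ (2 * H) * δ ^ (2 * H) := Real.mul_rpow (by norm_num) hδ0.le
      _ ≤ 4 * δ ^ (2 * H) := by
          gcongr
          calc (4 : ℝ) ^ (2 * H) ≤ 4 ^ (1 : ℝ) :=
                Real.rpow_le_rpow_of_exponent_le (by norm_num) (by linarith)
            _ = 4 := Real.rpow_one 4
  calc _ ≤ 1 / (8 * e * e') * (2 * ∫ v in (-(3 * δ))..3 * δ, g v) := h2
    _ ≤ 1 / (8 * e * e') * (2 * (4 * e' * (4 * δ ^ (2 * H)))) := by
        gcongr
        exact hB.trans (by gcongr)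
    _ = 4 * δ ^ (2 * H) * (1 / e) := by field_simp; ring
    _ ≤ 4 * δ ^ (2 * H) * (2 / δ) := by
        gcongr ?_ * ?_
        rw [div_le_div_iff₀ he hδ0]; linarith
    _ = 8 * δ ^ (2 * H - 1) := by
        rw [Real.rpow_sub_one hδ0.ne']; ring

theorem integral_abs_fbmKernel_le {H e e' : ℝ} (hH : 0 < H) (hH' : H < 1 / 2)
    (he : 0 < e) (he' : 0 < e') :
    ∫ r in (0 : ℝ)..2 * (e + e'), |fbmKernel H e e' r| ≤ 8 * (e + e') ^ (2 * H - 1) := by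
  rcases le_total e' e with h | h
  · exact integral_abs_fbmKernel_le_of_le hH hH' he' h
  · have := integral_abs_fbmKernel_le_of_le hH hH' he h
    rw [add_comm e' e] at this
    simpa only [fbmKernel_comm H e' e] using this

/-! ### The integrated kernel -/

theorem hasDerivAt_integral_abs_rpow {p : ℝ} (hp : 0 ≤ p) (y : ℝ) :
    HasDerivAt (fun y => ∫ x in (0 : ℝ)..y, |x| ^ p) (|y| ^ p) y :=
  have hc := continuous_abs_rpow hp
  intervalIntegral.integral_hasDerivAt_right (hc.intervalIntegrable _ _)
    (hc.stronglyMeasurableAtFilter _ _) hc.continuousAt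

/-- The primitive of `|x|^(2H)` is odd, so its mixed difference vanishes at `0` and only the
endpoint `θ` contributes. Thus the limit is the finite part of the divergent integral of `H(2H-1)
r^(2H-2)`. -/
theorem integral_fbmKernel {H : ℝ} (hH : 0 < H) (e e' θ : ℝ) :
    ∫ r in (0 : ℝ)..θ, fbmKernel H e e' r =
      (1 / 2) * mixedDiffQuot (fun y => ∫ x in (0 : ℝ)..y, |x| ^ (2 * H)) e e' θ := by
  have hodd : ∀ y : ℝ, ∫ x in (0 : ℝ)..(-y), |x| ^ (2 * H) = -∫ x in (0 : ℝ)..y, |x| ^ (2 * H) := by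
    intro y
    have := intervalIntegral.integral_comp_neg (a := 0) (b := y) (fun v => |v| ^ (2 * H))
    simp only [abs_neg, neg_zero] at this
    rw [this, intervalIntegral.integral_symm]
  have hd := hasDerivAt_integral_abs_rpow (show 0 ≤ 2 * H by positivity)
  set F : ℝ → ℝ := fun y => ∫ x in (0 : ℝ)..y, |x| ^ (2 * H) with hF
  have hd' : ∀ y, HasDerivAt (fun y => (1 / 2) * mixedDiffQuot F e e' y) (fbmKernel H e e' y) y := by
    intro y
    unfold fbmKernel mixedDiffQuot
    refine HasDerivAt.const_mul _ (HasDerivAt.div_const ?_ _)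
    have h1 := fun c => (hd (y + c)).comp_add_const y c
    have := (((h1 (e + e')).sub (h1 (e - e'))).sub (h1 (-e + e'))).add (h1 (-e - e'))
    have e1 : ∀ z : ℝ, z + e + e' = z + (e + e') := fun z => by ring
    have e2 : ∀ z : ℝ, z + e - e' = z + (e - e') := fun z => by ring
    have e3 : ∀ z : ℝ, z - e + e' = z + (-e + e') := fun z => by ring
    have e4 : ∀ z : ℝ, z - e - e' = z + (-e - e') := fun z => by ring
    simp only [e1, e2, e3, e4]
    exact this
  rw [intervalIntegral.integral_eq_sub_of_hasDerivAt (fun y _ => hd' y)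
    ((continuous_fbmKernel hH e e').intervalIntegrable _ _)]
  have h0 : mixedDiffQuot F e e' 0 = 0 := by
    unfold mixedDiffQuot
    rw [show (0 : ℝ) - e - e' = -(0 + e + e') by ring, show (0 : ℝ) - e + e' = -(0 + e - e') by ring,
      hF]
    simp only [hodd]
    ring
  rw [h0]; ring

theorem tendsto_integral_fbmKernel {H : ℝ} (hH : 0 < H) {θ : ℝ} (hθ : 0 < θ) :
    Tendsto (fun p : ℝ × ℝ => ∫ r in (0 : ℝ)..θ, fbmKernel H p.1 p.2 r) (𝓝[>] 0 ×ˢ 𝓝[>] 0)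
      (𝓝 (H * θ ^ (2 * H - 1))) := by
  simp only [integral_fbmKernel hH]
  have h := (tendsto_mixedDiffQuot (f := fun y => ∫ x in (0 : ℝ)..y, |x| ^ (2 * H)) hθ
    (fun y _ => hasDerivAt_integral_abs_rpow (by positivity) y)
    (fun y hy => hasDerivAt_abs_rpow hy)
    (continuousAt_const.mul (Real.continuousAt_rpow_const _ _ (Or.inl hθ.ne')))).const_mul (1 / 2)
  rwa [show 1 / 2 * (2 * H * θ ^ (2 * H - 1)) = H * θ ^ (2 * H - 1) by ring] at h

/-- A dominating function independent of the steps: the `L¹` bound serves when `θ ≤ 2(e + e')`, the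
mean value theorem otherwise. -/
theorem abs_integral_fbmKernel_le {H e e' θ : ℝ} (hH : 0 < H) (hH' : H < 1 / 2) (he : 0 < e)
    (he' : 0 < e') (hθ : 0 < θ) :
    |∫ r in (0 : ℝ)..θ, fbmKernel H e e' r| ≤ 16 * θ ^ (2 * H - 1) := by
  have hp : 2 * H - 1 ≤ 0 := by linarith
  have hhalf : (θ / 2) ^ (2 * H - 1) ≤ 2 * θ ^ (2 * H - 1) := by
    rw [Real.div_rpow hθ.le zero_le_two, div_eq_mul_inv, ← Real.rpow_neg zero_le_two, mul_comm]
    gcongr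
    calc (2 : ℝ) ^ (-(2 * H - 1)) ≤ (2 : ℝ) ^ (1 : ℝ) :=
          Real.rpow_le_rpow_of_exponent_le one_le_two (by linarith)
      _ = 2 := Real.rpow_one 2
  have hθp : 0 ≤ θ ^ (2 * H - 1) := by positivity
  rcases le_total θ (2 * (e + e')) with h | h
  · have hcont := (continuous_fbmKernel hH e e').abs
    calc |∫ r in (0 : ℝ)..θ, fbmKernel H e e' r| ≤ ∫ r in (0 : ℝ)..θ, |fbmKernel H e e' r| :=
          intervalIntegral.abs_integral_le_integral_abs hθ.le
      _ ≤ ∫ r in (0 : ℝ)..2 * (e + e'), |fbmKernel H e e' r| :=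
          intervalIntegral.integral_mono_interval le_rfl hθ.le h
            (ae_of_all _ fun _ => abs_nonneg _) (hcont.intervalIntegrable _ _)
      _ ≤ 8 * (e + e') ^ (2 * H - 1) := integral_abs_fbmKernel_le hH hH' he he'
      _ ≤ 8 * (θ / 2) ^ (2 * H - 1) := by
          gcongr 8 * ?_
          exact Real.rpow_le_rpow_of_nonpos (by positivity) (by linarith) hp
      _ ≤ 16 * θ ^ (2 * H - 1) := by linarith
  · rw [integral_fbmKernel hH]
    obtain ⟨ξ, hξ, h'⟩ := exists_mixedDiffQuot_eq
      (f := fun y => ∫ x in (0 : ℝ)..y, |x| ^ (2 * H)) (x := θ) he he'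
      (fun y _ => hasDerivAt_integral_abs_rpow (by positivity) y)
      (fun y hy => hasDerivAt_abs_rpow (by linarith))
    have h2 : θ / 2 ≤ ξ := by linarith [hξ.1]
    have h3 : ξ ^ (2 * H - 1) ≤ (θ / 2) ^ (2 * H - 1) :=
      Real.rpow_le_rpow_of_nonpos (by positivity) h2 hp
    have h4 : 0 ≤ ξ ^ (2 * H - 1) := Real.rpow_nonneg (by linarith) _
    rw [h', abs_of_nonneg (by positivity)]
    nlinarith

/-- Fubini after cutting the square along the diagonal; in each half `θ` is the larger variable and
`r` the gap. -/
theorem integral_integral_eq_triangles {h : ℝ → ℝ → ℝ} (hh : Continuous (Function.uncurry h))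
    {t : ℝ} (ht : 0 ≤ t) :
    ∫ s in (0 : ℝ)..t, ∫ r in (0 : ℝ)..t, h s r =
      ∫ θ in (0 : ℝ)..t, ∫ r in (0 : ℝ)..θ, (h θ (θ - r) + h (θ - r) θ) := by
  let μ : Measure ℝ := volume.restrict (Ioc 0 t)
  have hint : Integrable (Function.uncurry h) (μ.prod μ) := by
    rw [Measure.prod_restrict]
    exact (hh.continuousOn.integrableOn_compact (isCompact_Icc.prod isCompact_Icc)).mono_set
      (prod_mono Ioc_subset_Icc_self Ioc_subset_Icc_self)
  have hm1 : MeasurableSet {p : ℝ × ℝ | p.2 ≤ p.1} := measurableSet_le measurable_snd measurable_fst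
  have hm2 : MeasurableSet {p : ℝ × ℝ | p.1 < p.2} := measurableSet_lt measurable_fst measurable_snd
  have hi1 := hint.indicator hm1
  have hi2 := hint.indicator hm2
  have hsplit : Function.uncurry h = {p : ℝ × ℝ | p.2 ≤ p.1}.indicator (Function.uncurry h) +
      {p : ℝ × ℝ | p.1 < p.2}.indicator (Function.uncurry h) := by
    ext p
    by_cases hp : p.2 ≤ p.1
    · simp [indicator, hp, not_lt.2 hp]
    · simp [indicator, hp, not_le.1 hp]
  have hlow : ∫ p, {p : ℝ × ℝ | p.2 ≤ p.1}.indicator (Function.uncurry h) p ∂(μ.prod μ) =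
      ∫ θ in Ioc 0 t, ∫ r in (0 : ℝ)..θ, h θ r := by
    rw [integral_prod _ hi1]
    refine setIntegral_congr_fun measurableSet_Ioc fun θ hθ => ?_
    rw [intervalIntegral.integral_of_le hθ.1.le]
    have : (fun r => {p : ℝ × ℝ | p.2 ≤ p.1}.indicator (Function.uncurry h) (θ, r)) =
        (Iic θ).indicator (h θ) := by
      ext r; simp [indicator]
    rw [this, integral_indicator measurableSet_Iic, Measure.restrict_restrict measurableSet_Iic,
      inter_comm, Ioc_inter_Iic, inf_eq_right.2 hθ.2]
  have hupp : ∫ p, {p : ℝ × ℝ | p.1 < p.2}.indicator (Function.uncurry h) p ∂(μ.prod μ) =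
      ∫ θ in Ioc 0 t, ∫ r in (0 : ℝ)..θ, h r θ := by
    rw [integral_prod_symm _ hi2]
    refine setIntegral_congr_fun measurableSet_Ioc fun θ hθ => ?_
    rw [intervalIntegral.integral_of_le hθ.1.le]
    have : (fun r => {p : ℝ × ℝ | p.1 < p.2}.indicator (Function.uncurry h) (r, θ)) =
        (Iio θ).indicator (fun r => h r θ) := by
      ext r; simp [indicator]
    have hset : Iio θ ∩ Ioc 0 t = Ioo 0 θ := by
      ext r
      simp only [mem_inter_iff, mem_Iio, mem_Ioc, mem_Ioo]
      exact ⟨fun h => ⟨h.2.1, h.1⟩, fun h => ⟨h.2, h.1, h.2.le.trans hθ.2⟩⟩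
    rw [this, integral_indicator measurableSet_Iio, Measure.restrict_restrict measurableSet_Iio,
      hset, integral_Ioc_eq_integral_Ioo]
  have hc1 : ∀ θ, Continuous fun r => h θ r := fun θ =>
    hh.comp (by fun_prop : Continuous fun r : ℝ => (θ, r))
  have hc2 : ∀ θ, Continuous fun r => h r θ := fun θ =>
    hh.comp (by fun_prop : Continuous fun r : ℝ => (r, θ))
  have hcs : ∀ θ, Continuous fun r : ℝ => θ - r := fun θ => by fun_prop
  have h1 : Continuous fun θ => ∫ r in (0 : ℝ)..θ, h θ r :=
    intervalIntegral.continuous_parametric_intervalIntegral_of_continuous hh continuous_id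
  have h2 : Continuous fun θ => ∫ r in (0 : ℝ)..θ, h r θ :=
    intervalIntegral.continuous_parametric_intervalIntegral_of_continuous
      (f := fun θ r => h r θ) (hh.comp continuous_swap) continuous_id
  calc ∫ s in (0 : ℝ)..t, ∫ r in (0 : ℝ)..t, h s r
      = ∫ p, Function.uncurry h p ∂(μ.prod μ) := by
        rw [integral_prod _ hint]
        simp only [intervalIntegral.integral_of_le ht]
        rfl
    _ = (∫ θ in Ioc 0 t, ∫ r in (0 : ℝ)..θ, h θ r) + ∫ θ in Ioc 0 t, ∫ r in (0 : ℝ)..θ, h r θ := by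
        rw [← hlow, ← hupp, ← integral_add hi1 hi2]
        exact congrArg (fun f => ∫ p, f p ∂(μ.prod μ)) hsplit
    _ = ∫ θ in (0 : ℝ)..t, ∫ r in (0 : ℝ)..θ, (h θ (θ - r) + h (θ - r) θ) := by
        rw [← intervalIntegral.integral_of_le ht, ← intervalIntegral.integral_of_le ht,
          ← intervalIntegral.integral_add (h1.intervalIntegrable _ _) (h2.intervalIntegrable _ _)]
        refine intervalIntegral.integral_congr fun θ _ => ?_
        have hd1 : Continuous fun r => h θ (θ - r) := (hc1 θ).comp (hcs θ)
        have hd2 : Continuous fun r => h (θ - r) θ := (hc2 θ).comp (hcs θ)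
        rw [intervalIntegral.integral_add (hd1.intervalIntegrable _ _)
          (hd2.intervalIntegrable _ _),
          intervalIntegral.integral_comp_sub_left (fun r => h θ r),
          intervalIntegral.integral_comp_sub_left (fun r => h r θ), sub_self, sub_zero]

/-! ### Limits of kernel integrals over the triangle -/

section KernelIntegral

variable {H β C e e' : ℝ} {g : ℝ → ℝ}

/-- Near the diagonal `|g|` is at most `C (2δ)^β`, and the `L¹` bound on the kernel does the rest.
The resulting power of `e + e'` is positive once `β > 1 - 2H`. -/
theorem abs_integral_indicator_fbmKernel_mul_le (hH : 0 < H) (hH' : H < 1 / 2) (hβ : 0 ≤ β)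
    (hC : 0 ≤ C) (hg : ∀ r, 0 ≤ r → |g r| ≤ C * r ^ β)
    (he : 0 < e) (he' : 0 < e') {θ : ℝ} (hθ : 0 ≤ θ) :
    |∫ r in (0 : ℝ)..θ, (Iic (2 * (e + e'))).indicator (fun r => fbmKernel H e e' r * g r) r| ≤
      8 * 2 ^ β * C * (e + e') ^ (β + 2 * H - 1) := by
  set δ := e + e' with hδ
  have hδ0 : 0 < δ := by positivity
  have hV := continuous_fbmKernel hH e e'
  let B : ℝ → ℝ := fun r => C * (2 * δ) ^ β * |fbmKernel H e e' r|
  have hBc : Continuous B := continuous_const.mul hV.abs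
  have hB0 : ∀ r, 0 ≤ B r := fun r => by positivity
  have hle : ∀ r ∈ Ioc 0 θ, ‖(Iic (2 * δ)).indicator (fun r => fbmKernel H e e' r * g r) r‖ ≤
      (Iic (2 * δ)).indicator B r := by
    intro r hr
    by_cases hrδ : r ∈ Iic (2 * δ)
    · rw [indicator_of_mem hrδ, indicator_of_mem hrδ, Real.norm_eq_abs, abs_mul, mul_comm]
      refine mul_le_mul_of_nonneg_right ((hg r hr.1.le).trans ?_) (abs_nonneg _)
      exact mul_le_mul_of_nonneg_left (Real.rpow_le_rpow hr.1.le hrδ hβ) hC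
    · rw [indicator_of_notMem hrδ, indicator_of_notMem hrδ, norm_zero]
  have hBi : ∀ a b, IntegrableOn B (Ioc a b) := fun a b =>
    (hBc.integrableOn_Icc).mono_set Ioc_subset_Icc_self
  rw [intervalIntegral.integral_of_le hθ, ← Real.norm_eq_abs]
  calc _ ≤ ∫ r in Ioc 0 θ, (Iic (2 * δ)).indicator B r :=
        norm_integral_le_of_norm_le ((hBi 0 θ).indicator measurableSet_Iic)
          ((ae_restrict_iff' measurableSet_Ioc).2 (ae_of_all _ hle))
    _ = ∫ r in Iic (2 * δ) ∩ Ioc 0 θ, B r := by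
        rw [integral_indicator measurableSet_Iic, Measure.restrict_restrict measurableSet_Iic]
    _ ≤ ∫ r in Ioc 0 (2 * δ), B r :=
        setIntegral_mono_set (hBi _ _) (ae_of_all _ hB0)
          (LE.le.eventuallyLE fun r hr => ⟨hr.2.1, hr.1⟩)
    _ = C * (2 * δ) ^ β * ∫ r in (0 : ℝ)..2 * δ, |fbmKernel H e e' r| := by
        rw [← intervalIntegral.integral_of_le (by positivity), intervalIntegral.integral_const_mul]
    _ ≤ C * (2 * δ) ^ β * (8 * δ ^ (2 * H - 1)) := by
        gcongr
        exact integral_abs_fbmKernel_le hH hH' he he'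
    _ = 8 * 2 ^ β * C * δ ^ (β + 2 * H - 1) := by
        rw [Real.mul_rpow zero_le_two hδ0.le, show β + 2 * H - 1 = β + (2 * H - 1) by ring,
          Real.rpow_add hδ0]
        ring

theorem abs_indicator_fbmKernel_mul_le (hH : 0 < H) (hH' : H < 1 / 2)
    (hC : 0 ≤ C) (hg : ∀ r, 0 ≤ r → |g r| ≤ C * r ^ β)
    (he : 0 < e) (he' : 0 < e') {r : ℝ} (hr : 0 < r) :
    |(Ioi (2 * (e + e'))).indicator (fun r => fbmKernel H e e' r * g r) r| ≤
      4 * C * r ^ (2 * H - 2 + β) := by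
  by_cases h : r ∈ Ioi (2 * (e + e'))
  · rw [indicator_of_mem h, abs_mul, Real.rpow_add hr]
    calc _ ≤ 4 * r ^ (2 * H - 2) * (C * r ^ β) :=
          mul_le_mul (abs_fbmKernel_le hH hH' he he' (le_of_lt h)) (hg r hr.le) (abs_nonneg _)
            (by positivity)
      _ = _ := by ring
  · rw [indicator_of_notMem h, abs_zero]; positivity

theorem integral_fbmKernel_mul_eq_add (hH : 0 < H) (hgc : Continuous g) (e e' θ : ℝ) :
    ∫ r in (0 : ℝ)..θ, fbmKernel H e e' r * g r =
      (∫ r in (0 : ℝ)..θ,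
        (Iic (2 * (e + e'))).indicator (fun r => fbmKernel H e e' r * g r) r) +
      ∫ r in (0 : ℝ)..θ,
        (Ioi (2 * (e + e'))).indicator (fun r => fbmKernel H e e' r * g r) r := by
  have hc : Continuous fun r => fbmKernel H e e' r * g r := (continuous_fbmKernel hH e e').mul hgc
  have hi := fun a b => hc.intervalIntegrable (μ := volume) a b
  rw [← intervalIntegral.integral_add]
  · refine intervalIntegral.integral_congr fun r _ => ?_
    rw [← compl_Iic]
    exact (congrFun (indicator_self_add_compl (Iic (2 * (e + e')))
      (fun r => fbmKernel H e e' r * g r)) r).symm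
  · exact ⟨(hi 0 θ).1.indicator measurableSet_Iic, (hi 0 θ).2.indicator measurableSet_Iic⟩
  · exact ⟨(hi 0 θ).1.indicator measurableSet_Ioi, (hi 0 θ).2.indicator measurableSet_Ioi⟩

/-- A bound independent of `θ`, needed to dominate the outer integral. -/
theorem abs_integral_fbmKernel_mul_le (hH : 0 < H) (hH' : H < 1 / 2) (hβ : 1 - 2 * H < β)
    (hC : 0 ≤ C) (hgc : Continuous g) (hg : ∀ r, 0 ≤ r → |g r| ≤ C * r ^ β)
    (he : 0 < e) (he' : 0 < e') {θ t : ℝ} (hθ : 0 ≤ θ) (hθt : θ ≤ t) :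
    |∫ r in (0 : ℝ)..θ, fbmKernel H e e' r * g r| ≤
      8 * 2 ^ β * C * (e + e') ^ (β + 2 * H - 1) +
        ∫ r in (0 : ℝ)..t, 4 * C * r ^ (2 * H - 2 + β) := by
  have hi : ∀ a b, IntervalIntegrable (fun r : ℝ => 4 * C * r ^ (2 * H - 2 + β)) volume a b :=
    fun a b => (intervalIntegral.intervalIntegrable_rpow' (by linarith)).const_mul _
  rw [integral_fbmKernel_mul_eq_add hH hgc]
  refine (abs_add_le _ _).trans (add_le_add (abs_integral_indicator_fbmKernel_mul_le hH hH'
    (by linarith) hC hg he he' hθ) ?_)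
  calc _ ≤ ∫ r in (0 : ℝ)..θ, 4 * C * r ^ (2 * H - 2 + β) := by
        rw [← Real.norm_eq_abs]
        refine intervalIntegral.norm_integral_le_of_norm_le hθ (ae_of_all _ fun r hr => ?_) (hi _ _)
        exact abs_indicator_fbmKernel_mul_le hH hH' hC hg he he' hr.1
    _ ≤ _ := by
        refine intervalIntegral.integral_mono_interval le_rfl hθ hθt ?_ (hi _ _)
        refine (ae_restrict_iff' measurableSet_Ioc).2 (ae_of_all _ fun r hr => ?_)
        have := hr.1
        simp only [Pi.zero_apply]
        positivity

theorem tendsto_add_nhdsGT_prod :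
    Tendsto (fun p : ℝ × ℝ => p.1 + p.2) (𝓝[>] 0 ×ˢ 𝓝[>] 0) (𝓝 0) := by
  have h1 : Tendsto (fun p : ℝ × ℝ => p.1) (𝓝[>] 0 ×ˢ 𝓝[>] (0 : ℝ)) (𝓝 0) :=
    tendsto_fst.mono_right nhdsWithin_le_nhds
  have h2 : Tendsto (fun p : ℝ × ℝ => p.2) (𝓝[>] (0 : ℝ) ×ˢ 𝓝[>] 0) (𝓝 0) :=
    tendsto_snd.mono_right nhdsWithin_le_nhds
  simpa using h1.add h2

theorem eventually_pos_prod :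
    ∀ᶠ p : ℝ × ℝ in 𝓝[>] 0 ×ˢ 𝓝[>] 0, 0 < p.1 ∧ 0 < p.2 :=
  (eventually_mem_nhdsWithin (s := Ioi (0 : ℝ))).prod_mk eventually_mem_nhdsWithin

/-- The near part tends to `0`; the far part converges by domination by `4C r^(2H-2+β)`. -/
theorem tendsto_integral_fbmKernel_mul (hH : 0 < H) (hH' : H < 1 / 2) (hβ : 1 - 2 * H < β)
    (hC : 0 ≤ C) (hgc : Continuous g) (hg : ∀ r, 0 ≤ r → |g r| ≤ C * r ^ β) {θ : ℝ} (hθ : 0 ≤ θ) :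
    Tendsto (fun p : ℝ × ℝ => ∫ r in (0 : ℝ)..θ, fbmKernel H p.1 p.2 r * g r)
      (𝓝[>] 0 ×ˢ 𝓝[>] 0)
      (𝓝 (H * (2 * H - 1) * ∫ r in (0 : ℝ)..θ, r ^ (2 * H - 2) * g r)) := by
  simp only [integral_fbmKernel_mul_eq_add hH hgc]
  rw [← zero_add (H * (2 * H - 1) * _), ← intervalIntegral.integral_const_mul]
  refine Tendsto.add ?_ ?_
  · have h0 : Tendsto (fun p : ℝ × ℝ => 8 * 2 ^ β * C * (p.1 + p.2) ^ (β + 2 * H - 1))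
        (𝓝[>] 0 ×ˢ 𝓝[>] 0) (𝓝 0) := by
      have := (tendsto_add_nhdsGT_prod.rpow_const
        (Or.inr (by linarith : 0 ≤ β + 2 * H - 1))).const_mul (8 * 2 ^ β * C)
      rwa [Real.zero_rpow (by linarith), mul_zero] at this
    refine squeeze_zero_norm' ?_ h0
    filter_upwards [eventually_pos_prod] with p hp
    exact abs_integral_indicator_fbmKernel_mul_le hH hH' (by linarith) hC hg hp.1 hp.2 hθ
  · refine intervalIntegral.tendsto_integral_filter_of_dominated_convergence
      (fun r => 4 * C * r ^ (2 * H - 2 + β)) ?_ ?_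
      ((intervalIntegral.intervalIntegrable_rpow' (by linarith)).const_mul _) ?_
    · refine Eventually.of_forall fun p => Measurable.aestronglyMeasurable ?_
      exact ((continuous_fbmKernel hH _ _).mul hgc).measurable.indicator measurableSet_Ioi
    · filter_upwards [eventually_pos_prod] with p hp
      refine ae_of_all _ fun r hr => ?_
      rw [uIoc_of_le hθ] at hr
      exact abs_indicator_fbmKernel_mul_le hH hH' hC hg hp.1 hp.2 hr.1
    · refine ae_of_all _ fun r hr => ?_
      rw [uIoc_of_le hθ] at hr
      have := (tendsto_fbmKernel H hr.1).mul_const (g r)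
      rw [mul_assoc] at this
      refine this.congr' ?_
      -- A fixed `r > 0` eventually lies in the far region.
      filter_upwards [tendsto_add_nhdsGT_prod.eventually (gt_mem_nhds (half_pos hr.1))] with p hp
      rw [indicator_of_mem]
      simp only [mem_Ioi]
      linarith

/-- The limit of the time integrals of a Hölder-type correction, integrated over `[0,t]`. -/
theorem tendsto_integral_integral_fbmKernel_mul {k : ℝ → ℝ → ℝ} (hH : 0 < H) (hH' : H < 1 / 2)
    (hβ : 1 - 2 * H < β) (hC : 0 ≤ C) (hk : Continuous (Function.uncurry k))
    (hkb : ∀ θ r, 0 ≤ r → |k θ r| ≤ C * r ^ β) {t : ℝ} (ht : 0 ≤ t) :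
    Tendsto (fun p : ℝ × ℝ => ∫ θ in (0 : ℝ)..t, ∫ r in (0 : ℝ)..θ, fbmKernel H p.1 p.2 r * k θ r)
      (𝓝[>] 0 ×ˢ 𝓝[>] 0)
      (𝓝 (H * (2 * H - 1) * ∫ θ in (0 : ℝ)..t, ∫ r in (0 : ℝ)..θ, r ^ (2 * H - 2) * k θ r)) := by
  have hkc : ∀ θ, Continuous (k θ) := fun θ =>
    hk.comp (by fun_prop : Continuous fun r : ℝ => (θ, r))
  rw [← intervalIntegral.integral_const_mul]
  refine intervalIntegral.tendsto_integral_filter_of_dominated_convergence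
    (fun _ => 8 * 2 ^ β * C + ∫ r in (0 : ℝ)..t, 4 * C * r ^ (2 * H - 2 + β)) ?_ ?_ (by simp) ?_
  · refine Eventually.of_forall fun p => Continuous.aestronglyMeasurable ?_
    refine intervalIntegral.continuous_parametric_intervalIntegral_of_continuous ?_ continuous_id
    exact ((continuous_fbmKernel hH _ _).comp continuous_snd).mul hk
  · filter_upwards [eventually_pos_prod,
      tendsto_add_nhdsGT_prod.eventually (gt_mem_nhds zero_lt_one)] with p hp hp1
    refine ae_of_all _ fun θ hθ => ?_
    rw [uIoc_of_le ht] at hθ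
    refine (abs_integral_fbmKernel_mul_le hH hH' hβ hC (hkc θ) (hkb θ) hp.1 hp.2 hθ.1.le
      hθ.2).trans ?_
    -- Once `e + e' < 1`, the near-part bound is constant.
    have := Real.rpow_le_one (add_pos hp.1 hp.2).le hp1.le (by linarith : 0 ≤ β + 2 * H - 1)
    have h8 : 0 ≤ 8 * 2 ^ β * C := by positivity
    linarith [mul_le_of_le_one_right h8 this]
  · refine ae_of_all _ fun θ hθ => ?_
    rw [uIoc_of_le ht] at hθ
    exact tendsto_integral_fbmKernel_mul hH hH' hβ hC (hkc θ) (hkb θ) hθ.1.le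

theorem intervalIntegrable_rpow_mul_continuous {p : ℝ} (hp : -1 < p) {f : ℝ → ℝ}
    (hf : Continuous f) (a b : ℝ) : IntervalIntegrable (fun θ => θ ^ p * f θ) volume a b :=
  (intervalIntegral.intervalIntegrable_rpow' hp).mul_continuousOn hf.continuousOn

theorem tendsto_integral_mul_integral_fbmKernel {f : ℝ → ℝ} (hH : 0 < H) (hH' : H < 1 / 2)
    (hf : Continuous f) {t : ℝ} (ht : 0 ≤ t) :
    Tendsto (fun p : ℝ × ℝ =>
        ∫ θ in (0 : ℝ)..t, (∫ r in (0 : ℝ)..θ, fbmKernel H p.1 p.2 r) * f θ)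
      (𝓝[>] 0 ×ˢ 𝓝[>] 0) (𝓝 (H * ∫ θ in (0 : ℝ)..t, θ ^ (2 * H - 1) * f θ)) := by
  rw [← intervalIntegral.integral_const_mul]
  refine intervalIntegral.tendsto_integral_filter_of_dominated_convergence
    (fun θ => 16 * (θ ^ (2 * H - 1) * |f θ|)) ?_ ?_
    ((intervalIntegrable_rpow_mul_continuous (by linarith) hf.abs _ _).const_mul _) ?_
  · refine Eventually.of_forall fun p => Continuous.aestronglyMeasurable ?_
    exact (intervalIntegral.continuous_primitive
      (fun a b => (continuous_fbmKernel hH _ _).intervalIntegrable a b) 0).mul hf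
  · filter_upwards [eventually_pos_prod] with p hp
    refine ae_of_all _ fun θ hθ => ?_
    rw [uIoc_of_le ht] at hθ
    rw [Real.norm_eq_abs, abs_mul, ← mul_assoc]
    exact mul_le_mul_of_nonneg_right (abs_integral_fbmKernel_le hH hH' hp.1 hp.2 hθ.1)
      (abs_nonneg _)
  · refine ae_of_all _ fun θ hθ => ?_
    rw [uIoc_of_le ht] at hθ
    rw [← mul_assoc]
    exact (tendsto_integral_fbmKernel hH hθ.1).mul_const _

/-- The kernel is even, so on the triangle it multiplies `q θ (θ - r) + q (θ - r) θ`, which is `2 q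
θ θ` plus two increments of order `r^β`; each piece has its own limit. -/
theorem tendsto_integral_square_fbmKernel_mul {q : ℝ → ℝ → ℝ} (hH : 0 < H) (hH' : H < 1 / 2)
    (hβ : 1 - 2 * H < β) (hC : 0 ≤ C) (hq : Continuous (Function.uncurry q))
    (hq1 : ∀ θ r, 0 ≤ r → |q θ (θ - r) - q θ θ| ≤ C * r ^ β)
    (hq2 : ∀ θ r, 0 ≤ r → |q (θ - r) θ - q θ θ| ≤ C * r ^ β) {t : ℝ} (ht : 0 ≤ t) :
    Tendsto (fun p : ℝ × ℝ =>
        ∫ s in (0 : ℝ)..t, ∫ r in (0 : ℝ)..t, fbmKernel H p.1 p.2 (s - r) * q s r)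
      (𝓝[>] 0 ×ˢ 𝓝[>] 0)
      (𝓝 (2 * H * (∫ θ in (0 : ℝ)..t, θ ^ (2 * H - 1) * q θ θ)
        + H * (2 * H - 1) * (∫ θ in (0 : ℝ)..t, ∫ r in (0 : ℝ)..θ,
            r ^ (2 * H - 2) * (q θ (θ - r) - q θ θ))
        + H * (2 * H - 1) * (∫ θ in (0 : ℝ)..t, ∫ r in (0 : ℝ)..θ,
            r ^ (2 * H - 2) * (q (θ - r) θ - q θ θ)))) := by
  have hd : Continuous fun θ => q θ θ := hq.comp (by fun_prop : Continuous fun θ : ℝ => (θ, θ))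
  have hk1 : Continuous (Function.uncurry fun θ r => q θ (θ - r) - q θ θ) :=
    (hq.comp (by fun_prop : Continuous fun p : ℝ × ℝ => (p.1, p.1 - p.2))).sub
      (hd.comp continuous_fst)
  have hk2 : Continuous (Function.uncurry fun θ r => q (θ - r) θ - q θ θ) :=
    (hq.comp (by fun_prop : Continuous fun p : ℝ × ℝ => (p.1 - p.2, p.1))).sub
      (hd.comp continuous_fst)
  have hlim := (((tendsto_integral_mul_integral_fbmKernel hH hH' hd ht).const_mul 2).add
    (tendsto_integral_integral_fbmKernel_mul hH hH' hβ hC hk1 hq1 ht)).add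
    (tendsto_integral_integral_fbmKernel_mul hH hH' hβ hC hk2 hq2 ht)
  rw [← mul_assoc 2 H] at hlim
  refine hlim.congr fun p => ?_
  have hV := continuous_fbmKernel hH p.1 p.2
  have hslice : ∀ {k : ℝ → ℝ → ℝ}, Continuous (Function.uncurry k) → ∀ θ,
      IntervalIntegrable (fun r => fbmKernel H p.1 p.2 r * k θ r) volume 0 θ := fun hk θ =>
    (hV.mul (hk.comp (by fun_prop : Continuous fun r : ℝ => (θ, r)))).intervalIntegrable _ _
  have hpar : ∀ {k : ℝ → ℝ → ℝ}, Continuous (Function.uncurry k) →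
      IntervalIntegrable (fun θ => ∫ r in (0 : ℝ)..θ, fbmKernel H p.1 p.2 r * k θ r)
        volume 0 t := fun {k} hk =>
    (intervalIntegral.continuous_parametric_intervalIntegral_of_continuous
      (f := fun θ r => fbmKernel H p.1 p.2 r * k θ r)
      ((hV.comp continuous_snd).mul hk) continuous_id).intervalIntegrable _ _
  have hdiag : IntervalIntegrable
      (fun θ => 2 * ((∫ r in (0 : ℝ)..θ, fbmKernel H p.1 p.2 r) * q θ θ)) volume 0 t :=
    (continuous_const.mul ((intervalIntegral.continuous_primitive
      (fun a b => hV.intervalIntegrable a b) 0).mul hd)).intervalIntegrable _ _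
  rw [integral_integral_eq_triangles (h := fun s r => fbmKernel H p.1 p.2 (s - r) * q s r)
    ((hV.comp (by fun_prop : Continuous fun p : ℝ × ℝ => p.1 - p.2)).mul hq) ht,
    ← intervalIntegral.integral_const_mul, ← intervalIntegral.integral_add hdiag (hpar hk1),
    ← intervalIntegral.integral_add (hdiag.add (hpar hk1)) (hpar hk2)]
  refine intervalIntegral.integral_congr fun θ _ => ?_
  have h2 : 2 * ((∫ r in (0 : ℝ)..θ, fbmKernel H p.1 p.2 r) * q θ θ) =
      ∫ r in (0 : ℝ)..θ, fbmKernel H p.1 p.2 r * (2 * q θ θ) := by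
    rw [intervalIntegral.integral_mul_const]; ring
  have hi0 : IntervalIntegrable (fun r => fbmKernel H p.1 p.2 r * (2 * q θ θ)) volume 0 θ :=
    (hV.mul continuous_const).intervalIntegrable _ _
  rw [h2, ← intervalIntegral.integral_add hi0 (hslice hk1 θ),
    ← intervalIntegral.integral_add (hi0.add (hslice hk1 θ)) (hslice hk2 θ)]
  refine intervalIntegral.integral_congr fun r _ => ?_
  rw [show θ - (θ - r) = r by ring, show θ - r - θ = -r by ring, fbmKernel_neg]
  ring

theorem measurableSet_triangle (t : ℝ) : MeasurableSet (triangle t) :=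
  (measurableSet_lt measurable_const measurable_snd).inter
    ((measurableSet_le measurable_snd measurable_fst).inter
      (measurableSet_le measurable_fst measurable_const))

/-- The dominating function `C r^(2H-2+β)` does not depend on `θ` and is integrable on the square
containing the triangle. -/
theorem integrableOn_triangle_rpow_mul {k : ℝ → ℝ → ℝ} (hβ : 1 - 2 * H < β)
    (hk : Continuous (Function.uncurry k))
    (hkb : ∀ θ r, 0 ≤ r → |k θ r| ≤ C * r ^ β) (t : ℝ) :
    IntegrableOn (fun p : ℝ × ℝ => p.2 ^ (2 * H - 2) * k p.1 p.2) (triangle t) volume := by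
  have hsub : triangle t ⊆ Ioc 0 t ×ˢ Ioc 0 t := fun p hp =>
    ⟨⟨hp.1.trans_le hp.2.1, hp.2.2⟩, ⟨hp.1, hp.2.1.trans hp.2.2⟩⟩
  have hr : IntegrableOn (fun r : ℝ => C * r ^ (2 * H - 2 + β)) (Ioc 0 t) :=
    ((intervalIntegral.intervalIntegrable_rpow' (a := 0) (b := t) (by linarith)).1).const_mul _
  have hbound : IntegrableOn (fun p : ℝ × ℝ => C * p.2 ^ (2 * H - 2 + β)) (triangle t) volume := by
    refine IntegrableOn.mono_set ?_ hsub
    rw [IntegrableOn, Measure.volume_eq_prod, ← Measure.prod_restrict]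
    exact hr.comp_snd _
  refine hbound.mono' ?_ ?_
  · have h1 : Measurable fun p : ℝ × ℝ => p.2 ^ (2 * H - 2) := measurable_snd.pow_const _
    exact (h1.mul hk.measurable).aestronglyMeasurable
  · refine (ae_restrict_iff' (measurableSet_triangle t)).2 (ae_of_all _ fun p hp => ?_)
    have hp0 := hp.1
    rw [norm_mul, Real.norm_of_nonneg (by positivity), Real.rpow_add hp0]
    calc _ ≤ p.2 ^ (2 * H - 2) * (C * p.2 ^ β) :=
          mul_le_mul_of_nonneg_left (hkb _ _ hp0.le) (by positivity)
      _ = _ := by ring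

end KernelIntegral

/-! ### Mean-square limits from second moments -/

section SecondOrder

variable {Ω : Type*} [MeasurableSpace Ω] {P : Measure Ω}

theorem inner_toLp_two {X Y : Ω → ℝ} (hX : MemLp X 2 P) (hY : MemLp Y 2 P) :
    inner ℝ (hX.toLp X) (hY.toLp Y) = ∫ ω, X ω * Y ω ∂P := by
  rw [L2.inner_def]
  refine integral_congr_ae ?_
  filter_upwards [hX.coeFn_toLp, hY.coeFn_toLp] with ω h1 h2
  rw [h1, h2, real_inner_comm]
  rfl

/-- Expanding the square, `‖X_i - X_j‖²` tends to `c - 2c + c = 0`. The joint limit also controls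
the pairs `(i, i)` and `(j, j)`; completeness of `L²` concludes. -/
theorem exists_tendsto_eLpNorm_sub_of_tendsto_integral_mul {ι : Type*} {l : Filter ι} [l.NeBot]
    {X : ι → Ω → ℝ} (hX : ∀ i, MemLp (X i) 2 P) {c : ℝ}
    (h : Tendsto (fun p : ι × ι => ∫ ω, X p.1 ω * X p.2 ω ∂P) (l ×ˢ l) (𝓝 c)) :
    ∃ I : Ω → ℝ, MemLp I 2 P ∧
      Tendsto (fun i => eLpNorm (fun ω => X i ω - I ω) 2 P) l (𝓝 0) := by
  let F : ι → Lp ℝ 2 P := fun i => (hX i).toLp (X i)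
  have hsq : Tendsto (fun p : ι × ι => dist (F p.1) (F p.2) ^ 2) (l ×ˢ l) (𝓝 0) := by
    have h1 := h.comp ((tendsto_fst (f := l) (g := l)).prodMk (tendsto_fst (f := l) (g := l)))
    have h2 := h.comp ((tendsto_snd (f := l) (g := l)).prodMk (tendsto_snd (f := l) (g := l)))
    have h3 := (h1.sub (h.const_mul 2)).add h2
    rw [show c - 2 * c + c = 0 by ring] at h3
    refine h3.congr fun p => ?_
    rw [dist_eq_norm, norm_sub_sq_real, ← real_inner_self_eq_norm_sq,
      ← real_inner_self_eq_norm_sq]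
    simp only [F, inner_toLp_two, Function.comp_apply]
  have hdist : Tendsto (fun p : ι × ι => dist (F p.1) (F p.2)) (l ×ˢ l) (𝓝 0) := by
    have := hsq.sqrt
    simpa only [Real.sqrt_zero, Real.sqrt_sq dist_nonneg] using this
  have hcau : Cauchy (map F l) :=
    cauchy_map_iff.2 ⟨inferInstance, tendsto_uniformity_iff_dist_tendsto_zero.2 hdist⟩
  obtain ⟨f, hf⟩ := CompleteSpace.complete hcau
  refine ⟨f, Lp.memLp f, ?_⟩
  have hf' : Tendsto F l (𝓝 ((Lp.memLp f).toLp f)) := by rwa [Lp.toLp_coeFn]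
  exact (Lp.tendsto_Lp_iff_tendsto_eLpNorm'' X hX f (Lp.memLp f)).1 hf'

theorem tendsto_integral_mul_of_tendsto_eLpNorm_sub {ι : Type*} {l : Filter ι}
    {X Y : ι → Ω → ℝ} (hX : ∀ i, MemLp (X i) 2 P) (hY : ∀ i, MemLp (Y i) 2 P)
    {I J : Ω → ℝ} (hI : MemLp I 2 P) (hJ : MemLp J 2 P)
    (hXI : Tendsto (fun i => eLpNorm (fun ω => X i ω - I ω) 2 P) l (𝓝 0))
    (hYJ : Tendsto (fun i => eLpNorm (fun ω => Y i ω - J ω) 2 P) l (𝓝 0)) :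
    Tendsto (fun i => ∫ ω, X i ω * Y i ω ∂P) l (𝓝 (∫ ω, I ω * J ω ∂P)) := by
  have h1 := (Lp.tendsto_Lp_iff_tendsto_eLpNorm'' X hX I hI).2 hXI
  have h2 := (Lp.tendsto_Lp_iff_tendsto_eLpNorm'' Y hY J hJ).2 hYJ
  simpa only [inner_toLp_two] using h1.inner (𝕜 := ℝ) h2

/-- Fubini on `[0,t]² × Ω`: `|YZ| ≤ (Y² + Z²)/2` and the uniform second moments give integrability.
-/
theorem integral_mul_intervalIntegral [SFinite P] {Y Z : ℝ → Ω → ℝ}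
    (hY : Measurable (Function.uncurry Y)) (hZ : Measurable (Function.uncurry Z))
    (hY2 : ∀ s, MemLp (Y s) 2 P) (hZ2 : ∀ s, MemLp (Z s) 2 P) {B : ℝ}
    (hYB : ∀ s, ∫ ω, Y s ω * Y s ω ∂P ≤ B) (hZB : ∀ s, ∫ ω, Z s ω * Z s ω ∂P ≤ B)
    {t : ℝ} (ht : 0 ≤ t) :
    Integrable (fun ω => (∫ s in (0 : ℝ)..t, Y s ω) * ∫ s in (0 : ℝ)..t, Z s ω) P ∧
    ∫ ω, (∫ s in (0 : ℝ)..t, Y s ω) * (∫ s in (0 : ℝ)..t, Z s ω) ∂P =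
      ∫ s in (0 : ℝ)..t, ∫ r in (0 : ℝ)..t, ∫ ω, Y s ω * Z r ω ∂P := by
  let ν : Measure ℝ := volume.restrict (Ioc 0 t)
  let G : (ℝ × ℝ) × Ω → ℝ := fun p => Y p.1.1 p.2 * Z p.1.2 p.2
  have hG : Measurable G :=
    (hY.comp (by fun_prop : Measurable fun p : (ℝ × ℝ) × Ω => (p.1.1, p.2))).mul
      (hZ.comp (by fun_prop : Measurable fun p : (ℝ × ℝ) × Ω => (p.1.2, p.2)))
  have hYZ : ∀ s r, Integrable (fun ω => Y s ω * Z r ω) P := fun s r =>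
    (hY2 s).integrable_mul (hZ2 r)
  have hGi : Integrable G ((ν.prod ν).prod P) := by
    refine (integrable_prod_iff hG.aestronglyMeasurable).2
      ⟨ae_of_all _ fun p => hYZ p.1 p.2, ?_⟩
    refine (integrable_const B).mono' hG.aestronglyMeasurable.norm.integral_prod_right'
      (ae_of_all _ fun p => ?_)
    have hY' : Integrable (fun ω => Y p.1 ω * Y p.1 ω) P := (hY2 p.1).integrable_mul (hY2 p.1)
    have hZ' : Integrable (fun ω => Z p.2 ω * Z p.2 ω) P := (hZ2 p.2).integrable_mul (hZ2 p.2)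
    rw [Real.norm_of_nonneg (integral_nonneg fun _ => norm_nonneg _)]
    calc ∫ ω, ‖G (p, ω)‖ ∂P
        ≤ ∫ ω, (1 / 2 * (Y p.1 ω * Y p.1 ω) + 1 / 2 * (Z p.2 ω * Z p.2 ω)) ∂P := by
          refine integral_mono (hYZ p.1 p.2).norm ((hY'.const_mul _).add (hZ'.const_mul _))
            fun ω => ?_
          simp only [G, Real.norm_eq_abs, abs_mul]
          nlinarith [sq_nonneg (|Y p.1 ω| - |Z p.2 ω|), abs_mul_abs_self (Y p.1 ω),
            abs_mul_abs_self (Z p.2 ω)]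
      _ = 1 / 2 * (∫ ω, Y p.1 ω * Y p.1 ω ∂P) + 1 / 2 * ∫ ω, Z p.2 ω * Z p.2 ω ∂P := by
          rw [integral_add (hY'.const_mul _) (hZ'.const_mul _), integral_const_mul,
            integral_const_mul]
      _ ≤ B := by linarith [hYB p.1, hZB p.2]
  have hprod : ∀ ω, (∫ s in (0 : ℝ)..t, Y s ω) * (∫ s in (0 : ℝ)..t, Z s ω) =
      ∫ p, G (p, ω) ∂(ν.prod ν) := fun ω => by
    rw [intervalIntegral.integral_of_le ht, intervalIntegral.integral_of_le ht]
    exact (integral_prod_mul (fun s => Y s ω) (fun s => Z s ω)).symm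
  simp only [hprod]
  refine ⟨hGi.integral_prod_right, ?_⟩
  rw [integral_integral_swap (f := fun ω p => G (p, ω)) hGi.swap,
    integral_prod _ hGi.integral_prod_left]
  simp only [intervalIntegral.integral_of_le ht]
  rfl

end SecondOrder

/-! ### Approximating integrals of the fractional field -/

section Field

variable {Ω : Type*} [MeasurableSpace Ω] {P : Measure Ω} {d : ℕ} {H : ℝ}
  {Q : EuclideanSpace ℝ (Fin d) → EuclideanSpace ℝ (Fin d) → ℝ}
  {W : ℝ → EuclideanSpace ℝ (Fin d) → Ω → ℝ}

/-- Gaussianity enters here, as finiteness of second moments; the later computations use the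
covariance. -/
theorem IsFractionalField.memLp_two (hW : IsFractionalField P W H Q) (t : ℝ)
    (x : EuclideanSpace ℝ (Fin d)) : MemLp (W t x) 2 P :=
  (hW.gaussian.hasGaussianLaw_eval (t, x)).memLp_two

theorem IsFractionalField.memLp_Wdot (hW : IsFractionalField P W H Q) (ε s : ℝ)
    (x : EuclideanSpace ℝ (Fin d)) : MemLp (Wdot W ε s x) 2 P :=
  ((hW.memLp_two _ x).sub (hW.memLp_two _ x)).const_mul _

/-- In the mixed difference of the covariance the terms in one time only cancel, leaving a function
of `s - r`. -/
theorem IsFractionalField.integral_Wdot_mul_Wdot (hW : IsFractionalField P W H Q)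
    (ε ε' s r : ℝ) (x y : EuclideanSpace ℝ (Fin d)) :
    ∫ ω, Wdot W ε s x ω * Wdot W ε' r y ω ∂P = fbmKernel H ε ε' (s - r) * Q x y := by
  have hi : ∀ a b, Integrable (fun ω => W a x ω * W b y ω) P := fun a b =>
    (hW.memLp_two a x).integrable_mul (hW.memLp_two b y)
  have hi' : ∀ a b c, Integrable (fun ω => W a x ω * W b y ω - W a x ω * W c y ω) P :=
    fun a b c => (hi a b).sub (hi a c)
  have hexp : ∀ ω, Wdot W ε s x ω * Wdot W ε' r y ω = (1 / (2 * ε) * (1 / (2 * ε'))) *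
      ((W (s + ε) x ω * W (r + ε') y ω - W (s + ε) x ω * W (r - ε') y ω) -
        (W (s - ε) x ω * W (r + ε') y ω - W (s - ε) x ω * W (r - ε') y ω)) := fun ω => by
    unfold Wdot; ring
  simp only [hexp]
  rw [integral_const_mul, integral_sub (hi' _ _ _) (hi' _ _ _),
    integral_sub (hi _ _) (hi _ _), integral_sub (hi _ _) (hi _ _)]
  simp only [hW.covariance]
  unfold fbmCov fbmKernel mixedDiffQuot
  rw [show s + ε - (r + ε') = s - r + ε - ε' by ring,
    show s + ε - (r - ε') = s - r + ε + ε' by ring,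
    show s - ε - (r + ε') = s - r - ε - ε' by ring,
    show s - ε - (r - ε') = s - r - ε + ε' by ring]
  ring

variable {φ ψ : ℝ → EuclideanSpace ℝ (Fin d)} {B : ℝ}

theorem IsFractionalField.measurable_Wdot_comp (hW : IsFractionalField P W H Q)
    (hφ : Measurable φ) (ε : ℝ) :
    Measurable (Function.uncurry fun s ω => Wdot W ε s (φ s) ω) := by
  have h : ∀ c : ℝ, Measurable fun p : ℝ × Ω => W (p.1 + c) (φ p.1) p.2 := fun c =>
    hW.measurable.comp (((measurable_fst.add_const c).prodMk (hφ.comp measurable_fst)).prodMk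
      measurable_snd)
  exact measurable_const.mul ((h ε).sub (by simpa only [sub_eq_add_neg] using h (-ε)))

theorem IsFractionalField.approxIntegral_mul [SFinite P] (hW : IsFractionalField P W H Q)
    (hφ : Measurable φ) (hψ : Measurable ψ) (hφB : ∀ s, |Q (φ s) (φ s)| ≤ B)
    (hψB : ∀ s, |Q (ψ s) (ψ s)| ≤ B) {t : ℝ} (ht : 0 ≤ t) (ε ε' : ℝ) :
    Integrable (fun ω => approxIntegral W φ t ε ω * approxIntegral W ψ t ε' ω) P ∧
    ∫ ω, approxIntegral W φ t ε ω * approxIntegral W ψ t ε' ω ∂P =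
      ∫ s in (0 : ℝ)..t, ∫ r in (0 : ℝ)..t, fbmKernel H ε ε' (s - r) * Q (φ s) (ψ r) := by
  have hB : 0 ≤ B := (abs_nonneg _).trans (hφB 0)
  -- The second moment is the kernel at `0` times a diagonal value of `Q`. The larger of the two
  -- kernel values supplies a bound common to both paths.
  have hbd : ∀ {χ : ℝ → EuclideanSpace ℝ (Fin d)}, (∀ s, |Q (χ s) (χ s)| ≤ B) → ∀ e a b : ℝ,
      a = |fbmKernel H e e 0| → a ≤ b → ∀ s,
      ∫ ω, Wdot W e s (χ s) ω * Wdot W e s (χ s) ω ∂P ≤ b * B := by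
    intro χ hχ e a b ha hab s
    rw [hW.integral_Wdot_mul_Wdot, sub_self]
    refine (le_abs_self _).trans ?_
    rw [abs_mul, ← ha]
    exact mul_le_mul hab (hχ s) (abs_nonneg _) ((ha ▸ abs_nonneg _ : (0 : ℝ) ≤ a).trans hab)
  have := integral_mul_intervalIntegral (P := P) (hW.measurable_Wdot_comp hφ ε)
    (hW.measurable_Wdot_comp hψ ε') (fun s => hW.memLp_Wdot ε s _)
    (fun s => hW.memLp_Wdot ε' s _)
    (hbd hφB ε _ (max |fbmKernel H ε ε 0| |fbmKernel H ε' ε' 0|) rfl (le_max_left _ _))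
    (hbd hψB ε' _ _ rfl (le_max_right _ _)) ht
  simp only [hW.integral_Wdot_mul_Wdot] at this
  exact this

theorem IsFractionalField.memLp_approxIntegral [SFinite P] (hW : IsFractionalField P W H Q)
    (hφ : Measurable φ) (hφB : ∀ s, |Q (φ s) (φ s)| ≤ B) {t : ℝ} (ht : 0 ≤ t) (ε : ℝ) :
    MemLp (approxIntegral W φ t ε) 2 P := by
  have hm : StronglyMeasurable (approxIntegral W φ t ε) := by
    have := (hW.measurable_Wdot_comp hφ ε).stronglyMeasurable.integral_prod_left
      (μ := volume.restrict (Ioc 0 t))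
    have heq : approxIntegral W φ t ε = fun ω => ∫ s in Ioc 0 t, Wdot W ε s (φ s) ω := by
      ext ω
      rw [approxIntegral, intervalIntegral.integral_of_le ht]
    rw [heq]
    exact this
  refine (memLp_two_iff_integrable_sq hm.aestronglyMeasurable).2 ?_
  simpa only [sq] using (hW.approxIntegral_mul hφ hφ hφB hφB ht ε ε).1

/-- Existence and covariance of nonlinear integrals from the convergence of the covariances of the
approximating integrals. -/
theorem IsFractionalField.exists_isNonlinearIntegral [SFinite P] (hW : IsFractionalField P W H Q)
    (hφ : Measurable φ) (hφB : ∀ s, |Q (φ s) (φ s)| ≤ B) {t : ℝ} (ht : 0 ≤ t) {c : ℝ}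
    (hlim : Tendsto (fun p : ℝ × ℝ => ∫ s in (0 : ℝ)..t, ∫ r in (0 : ℝ)..t,
      fbmKernel H p.1 p.2 (s - r) * Q (φ s) (φ r)) (𝓝[>] 0 ×ˢ 𝓝[>] 0) (𝓝 c)) :
    ∃ I, IsNonlinearIntegral P W φ t I := by
  have hX := hW.memLp_approxIntegral hφ hφB ht
  obtain ⟨I, hI, hI'⟩ := exists_tendsto_eLpNorm_sub_of_tendsto_integral_mul hX
    (hlim.congr fun p => ((hW.approxIntegral_mul hφ hφ hφB hφB ht p.1 p.2).2).symm)
  exact ⟨I, hI, fun ε _ => hX ε, hI'⟩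

/-- Continuity of the `L²` inner product along `ε = ε'`, then uniqueness of limits. -/
theorem IsFractionalField.integral_mul_eq [SFinite P] (hW : IsFractionalField P W H Q)
    (hφ : Measurable φ) (hψ : Measurable ψ) (hφB : ∀ s, |Q (φ s) (φ s)| ≤ B)
    (hψB : ∀ s, |Q (ψ s) (ψ s)| ≤ B) {t : ℝ} (ht : 0 ≤ t) {c : ℝ}
    (hlim : Tendsto (fun p : ℝ × ℝ => ∫ s in (0 : ℝ)..t, ∫ r in (0 : ℝ)..t,
      fbmKernel H p.1 p.2 (s - r) * Q (φ s) (ψ r)) (𝓝[>] 0 ×ˢ 𝓝[>] 0) (𝓝 c))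
    {I J : Ω → ℝ} (hI : IsNonlinearIntegral P W φ t I) (hJ : IsNonlinearIntegral P W ψ t J) :
    ∫ ω, I ω * J ω ∂P = c := by
  have h1 := tendsto_integral_mul_of_tendsto_eLpNorm_sub (hW.memLp_approxIntegral hφ hφB ht)
    (hW.memLp_approxIntegral hψ hψB ht) hI.1 hJ.1 hI.2.2 hJ.2.2
  refine tendsto_nhds_unique h1 ((hlim.comp (tendsto_id.prodMk tendsto_id)).congr fun ε => ?_)
  exact ((hW.approxIntegral_mul hφ hψ hφB hψB ht ε ε).2).symm

end Field

/-! ### Regularity of the covariance along Hölder paths -/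

section Paths

variable {d : ℕ} {φ ψ : ℝ → EuclideanSpace ℝ (Fin d)} {M γ : ℝ} {α : ℝ≥0}
  {Q : EuclideanSpace ℝ (Fin d) → EuclideanSpace ℝ (Fin d) → ℝ}

/-- A Hölder path on `[0,T]`, stopped at the ends of `[0,t] ⊆ [0,T]`, is a bounded globally
Hölder path. -/
theorem IsHolderPath.exists_extension {T t : ℝ} (hφ : IsHolderPath α T φ) (ht : 0 ≤ t)
    (htT : t ≤ T) (hα : 0 < α) :
    ∃ φ' : ℝ → EuclideanSpace ℝ (Fin d), EqOn φ' φ (Icc 0 t) ∧ Continuous φ' ∧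
      (∃ C : ℝ, 0 ≤ C ∧ ∀ s r, ‖φ' s - φ' r‖ ≤ C * |s - r| ^ (α : ℝ)) ∧
      ∃ K : ℝ, 0 < K ∧ ∀ s, ‖φ' s‖ ≤ K := by
  obtain ⟨C, hC⟩ := hφ
  have hmem : ∀ s, (projIcc 0 t ht s : ℝ) ∈ Icc 0 T := fun s =>
    ⟨(projIcc 0 t ht s).2.1, (projIcc 0 t ht s).2.2.trans htT⟩
  have hcont : ContinuousOn φ (Icc 0 T) := hC.continuousOn hα
  refine ⟨fun s => φ (projIcc 0 t ht s), fun s hs => ?_, ?_, ⟨C, C.2, fun s r => ?_⟩, ?_⟩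
  · simp only [projIcc_of_mem ht hs]
  · exact hcont.comp_continuous (continuous_subtype_val.comp continuous_projIcc) hmem
  · rw [← dist_eq_norm]
    refine (hC.dist_le (hmem s) (hmem r)).trans ?_
    -- The projection is 1-Lipschitz, so stopping preserves the Hölder constant.
    have h := (LipschitzWith.projIcc ht).dist_le_mul s r
    rw [NNReal.coe_one, one_mul, Subtype.dist_eq, Real.dist_eq s r] at h
    gcongr
  · obtain ⟨K, hK⟩ := isCompact_Icc.exists_bound_of_continuousOn hcont
    exact ⟨max K 1, by positivity, fun s => (hK _ (hmem s)).trans (le_max_left _ _)⟩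

/-- Comparison with `Q 0 0` through the Hölder estimate on the ball of radius `K`. -/
theorem LocallyHolderCov.exists_abs_diag_le (hQ : LocallyHolderCov M γ Q) {K : ℝ} (hK : 0 < K)
    (hγ : 0 < γ) (hφK : ∀ s, ‖φ s‖ ≤ K) : ∃ B, ∀ s, |Q (φ s) (φ s)| ≤ B := by
  obtain ⟨C, hC, h⟩ := hQ
  refine ⟨C * (1 + K) ^ M * (K ^ γ + K ^ γ) + |Q 0 0|, fun s => ?_⟩
  have h1 := h K hK (φ s) (φ s) 0 0 (hφK s) (hφK s) (by simpa using hK.le) (by simpa using hK.le)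
  rw [sub_zero] at h1
  have h2 : C * (1 + K) ^ M * (‖φ s‖ ^ γ + ‖φ s‖ ^ γ) ≤ C * (1 + K) ^ M * (K ^ γ + K ^ γ) := by
    gcongr <;> exact hφK s
  linarith [abs_sub_abs_le_abs_sub (Q (φ s) (φ s)) (Q 0 0)]

/-- Composing the exponents `α` and `γ` gives `αγ`; both paths stay in the ball of radius `max K L`.
-/
theorem LocallyHolderCov.exists_abs_sub_le (hQ : LocallyHolderCov M γ Q) (hγ : 0 < γ)
    {K L : ℝ} (hK : 0 < K) (hφK : ∀ s, ‖φ s‖ ≤ K) (hψL : ∀ s, ‖ψ s‖ ≤ L) {C D : ℝ} (hC : 0 ≤ C)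
    (hD : 0 ≤ D) (hφ : ∀ s r, ‖φ s - φ r‖ ≤ C * |s - r| ^ (α : ℝ))
    (hψ : ∀ s r, ‖ψ s - ψ r‖ ≤ D * |s - r| ^ (α : ℝ)) :
    ∃ A, 0 ≤ A ∧ ∀ s r s' r', |Q (φ s) (ψ r) - Q (φ s') (ψ r')| ≤
      A * (|s - s'| ^ (α * γ) + |r - r'| ^ (α * γ)) := by
  obtain ⟨C₁, hC₁, h⟩ := hQ
  set N := max K L with hN
  have hN0 : 0 < N := lt_max_of_lt_left hK
  have hpow : ∀ {χ : ℝ → EuclideanSpace ℝ (Fin d)} {E : ℝ}, 0 ≤ E → E ≤ max C D →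
      (∀ s r, ‖χ s - χ r‖ ≤ E * |s - r| ^ (α : ℝ)) → ∀ s r,
      ‖χ s - χ r‖ ^ γ ≤ (max C D) ^ γ * |s - r| ^ (α * γ) := by
    intro χ E hE hEm hχ s r
    calc ‖χ s - χ r‖ ^ γ ≤ (max C D * |s - r| ^ (α : ℝ)) ^ γ := by
          refine Real.rpow_le_rpow (norm_nonneg _) ((hχ s r).trans ?_) hγ.le
          gcongr
      _ = _ := by
          rw [Real.mul_rpow (hE.trans hEm) (by positivity), ← Real.rpow_mul (abs_nonneg _)]
  refine ⟨C₁ * (1 + N) ^ M * (max C D) ^ γ, by positivity, fun s r s' r' => ?_⟩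
  have hφN := fun s => (hφK s).trans (le_max_left K L)
  have hψN := fun s => (hψL s).trans (le_max_right K L)
  calc _ ≤ C₁ * (1 + N) ^ M * (‖φ s - φ s'‖ ^ γ + ‖ψ r - ψ r'‖ ^ γ) :=
        h N hN0 _ _ _ _ (hφN s) (hψN r) (hφN s') (hψN r')
    _ ≤ C₁ * (1 + N) ^ M * ((max C D) ^ γ * |s - s'| ^ (α * γ) +
          (max C D) ^ γ * |r - r'| ^ (α * γ)) := by
        gcongr
        · exact hpow hC (le_max_left _ _) hφ s s'
        · exact hpow hD (le_max_right _ _) hψ r r'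
    _ = _ := by ring

theorem continuous_of_abs_sub_le {q : ℝ → ℝ → ℝ} {A β : ℝ} (hβ : 0 < β)
    (hq : ∀ s r s' r', |q s r - q s' r'| ≤ A * (|s - s'| ^ β + |r - r'| ^ β)) :
    Continuous (Function.uncurry q) := by
  refine continuous_iff_continuousAt.2 fun p => ?_
  have hc : Continuous fun p' : ℝ × ℝ => A * (|p'.1 - p.1| ^ β + |p'.2 - p.2| ^ β) :=
    continuous_const.mul
      (((continuous_abs_rpow hβ.le).comp (by fun_prop : Continuous fun p' : ℝ × ℝ => p'.1 - p.1)).add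
      ((continuous_abs_rpow hβ.le).comp (by fun_prop : Continuous fun p' : ℝ × ℝ => p'.2 - p.2)))
  have h0 := hc.tendsto p
  simp only [sub_self, abs_zero, Real.zero_rpow hβ.ne', add_zero, mul_zero] at h0
  exact tendsto_iff_dist_tendsto_zero.2 (squeeze_zero (fun _ => dist_nonneg)
    (fun p' => hq p'.1 p'.2 p.1 p.2) h0)

theorem approxIntegral_congr {Ω : Type*} (W : ℝ → EuclideanSpace ℝ (Fin d) → Ω → ℝ) {t : ℝ}
    (ht : 0 ≤ t) (h : EqOn φ ψ (Icc 0 t)) : approxIntegral W φ t = approxIntegral W ψ t := by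
  ext ε ω
  refine intervalIntegral.integral_congr fun s hs => ?_
  rw [uIcc_of_le ht] at hs
  simp only [h hs]

theorem isNonlinearIntegral_congr {Ω : Type*} [MeasurableSpace Ω] {P : Measure Ω}
    {W : ℝ → EuclideanSpace ℝ (Fin d) → Ω → ℝ} {t : ℝ} (ht : 0 ≤ t) (h : EqOn φ ψ (Icc 0 t))
    {I : Ω → ℝ} : IsNonlinearIntegral P W φ t I ↔ IsNonlinearIntegral P W ψ t I := by
  simp only [IsNonlinearIntegral, approxIntegral_congr W ht h]

end Paths

end NonlinearFBM

/-! ### Assembly -/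

theorem mainTheorem7 {Ω : Type*} [MeasurableSpace Ω] (P : Measure Ω) [IsProbabilityMeasure P]
    (d : ℕ) (H M γ : ℝ) (hH : 0 < H) (hH' : H < 1 / 2) (hM : M < 2) (hγ : 0 < γ) (hγ' : γ ≤ 1)
    (Q : EuclideanSpace ℝ (Fin d) → EuclideanSpace ℝ (Fin d) → ℝ)
    (hQ1 : NonlinearFBM.LocallyBoundedCov M Q) (hQ2 : NonlinearFBM.LocallyHolderCov M γ Q)
    (W : ℝ → EuclideanSpace ℝ (Fin d) → Ω → ℝ)
    (hW : NonlinearFBM.IsFractionalField P W H Q)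
    (T t : ℝ) (ht : 0 ≤ t) (htT : t ≤ T)
    (α : ℝ≥0) (hα : 1 - 2 * H < (α : ℝ) * γ)
    (φ ψ : ℝ → EuclideanSpace ℝ (Fin d))
    (hφ : NonlinearFBM.IsHolderPath α T φ) (hψ : NonlinearFBM.IsHolderPath α T ψ) :
    -- both stochastic integrals exist
    (∃ I : Ω → ℝ, NonlinearFBM.IsNonlinearIntegral P W φ t I) ∧
    (∃ J : Ω → ℝ, NonlinearFBM.IsNonlinearIntegral P W ψ t J) ∧
    -- the three deterministic integrals converge absolutely
    IntervalIntegrable (fun θ : ℝ => θ ^ (2 * H - 1) * Q (φ θ) (ψ θ)) volume 0 t ∧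
    IntegrableOn (fun p : ℝ × ℝ => p.2 ^ (2 * H - 2) *
      (Q (φ p.1) (ψ (p.1 - p.2)) - Q (φ p.1) (ψ p.1))) (NonlinearFBM.triangle t) volume ∧
    IntegrableOn (fun p : ℝ × ℝ => p.2 ^ (2 * H - 2) *
      (Q (φ (p.1 - p.2)) (ψ p.1) - Q (φ p.1) (ψ p.1))) (NonlinearFBM.triangle t) volume ∧
    -- the covariance formula
    ∀ I J : Ω → ℝ, NonlinearFBM.IsNonlinearIntegral P W φ t I →
      NonlinearFBM.IsNonlinearIntegral P W ψ t J →
      Integrable (fun ω => I ω * J ω) P ∧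
      ∫ ω, I ω * J ω ∂P =
        2 * H * (∫ θ in (0 : ℝ)..t, θ ^ (2 * H - 1) * Q (φ θ) (ψ θ))
        + H * (2 * H - 1) * (∫ θ in (0 : ℝ)..t, ∫ r in (0 : ℝ)..θ,
            r ^ (2 * H - 2) * (Q (φ θ) (ψ (θ - r)) - Q (φ θ) (ψ θ)))
        + H * (2 * H - 1) * (∫ θ in (0 : ℝ)..t, ∫ r in (0 : ℝ)..θ,
            r ^ (2 * H - 2) * (Q (φ (θ - r)) (ψ θ) - Q (φ θ) (ψ θ))) := by
  open NonlinearFBM in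
  have hβ0 : 0 < (α : ℝ) * γ := by linarith
  have hα0 : 0 < α := by
    rcases eq_zero_or_pos α with h | h
    · simp [h] at hβ0
    · exact h
  -- Stopped paths have global bounds and continuity, as the kernel lemmas require; both sides of
  -- the formula see only `[0,t]`.
  obtain ⟨φ', hφe, hφc, ⟨C, hC, hφC⟩, K, hK, hφK⟩ := hφ.exists_extension ht htT hα0
  obtain ⟨ψ', hψe, hψc, ⟨D, hD, hψD⟩, L, hL, hψL⟩ := hψ.exists_extension ht htT hα0
  obtain ⟨B₁, hB₁⟩ := hQ2.exists_abs_diag_le hK hγ hφK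
  obtain ⟨B₂, hB₂⟩ := hQ2.exists_abs_diag_le hL hγ hψL
  have hφB : ∀ s, |Q (φ' s) (φ' s)| ≤ max B₁ B₂ := fun s => (hB₁ s).trans (le_max_left _ _)
  have hψB : ∀ s, |Q (ψ' s) (ψ' s)| ≤ max B₁ B₂ := fun s => (hB₂ s).trans (le_max_right _ _)
  -- With one argument fixed its modulus is `0^(αγ) = 0`, since `αγ > 0`.
  have inc1 : ∀ {q : ℝ → ℝ → ℝ} {A : ℝ}, (∀ s r s' r', |q s r - q s' r'| ≤
      A * (|s - s'| ^ (α * γ) + |r - r'| ^ (α * γ))) → ∀ θ r, 0 ≤ r →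
      |q θ (θ - r) - q θ θ| ≤ A * r ^ (α * γ) := fun hq θ r hr => by
    simpa [Real.zero_rpow hβ0.ne', abs_of_nonneg hr] using hq θ (θ - r) θ θ
  have inc2 : ∀ {q : ℝ → ℝ → ℝ} {A : ℝ}, (∀ s r s' r', |q s r - q s' r'| ≤
      A * (|s - s'| ^ (α * γ) + |r - r'| ^ (α * γ))) → ∀ θ r, 0 ≤ r →
      |q (θ - r) θ - q θ θ| ≤ A * r ^ (α * γ) := fun hq θ r hr => by
    simpa [Real.zero_rpow hβ0.ne', abs_of_nonneg hr] using hq (θ - r) θ θ θ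
  -- The pairs `(φ, φ)` and `(ψ, ψ)` serve existence; `(φ, ψ)` gives the covariance.
  obtain ⟨A₁, hA₁, hq₁⟩ := hQ2.exists_abs_sub_le hγ hK hφK hφK hC hC hφC hφC
  obtain ⟨A₂, hA₂, hq₂⟩ := hQ2.exists_abs_sub_le hγ hL hψL hψL hD hD hψD hψD
  obtain ⟨A, hA, hq⟩ := hQ2.exists_abs_sub_le hγ hK hφK hψL hC hD hφC hψD
  have hlim₁ := tendsto_integral_square_fbmKernel_mul hH hH' hα hA₁
    (continuous_of_abs_sub_le (q := fun s r => Q (φ' s) (φ' r)) hβ0 hq₁) (inc1 hq₁) (inc2 hq₁) ht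
  have hlim₂ := tendsto_integral_square_fbmKernel_mul hH hH' hα hA₂
    (continuous_of_abs_sub_le (q := fun s r => Q (ψ' s) (ψ' r)) hβ0 hq₂) (inc1 hq₂) (inc2 hq₂) ht
  have hqc := continuous_of_abs_sub_le (q := fun s r => Q (φ' s) (ψ' r)) hβ0 hq
  have hlim := tendsto_integral_square_fbmKernel_mul hH hH' hα hA hqc (inc1 hq) (inc2 hq) ht
  have hdiag : Continuous fun θ => Q (φ' θ) (ψ' θ) :=
    hqc.comp (by fun_prop : Continuous fun θ : ℝ => (θ, θ))
  have hk1 : Continuous (Function.uncurry fun θ r =>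
      Q (φ' θ) (ψ' (θ - r)) - Q (φ' θ) (ψ' θ)) :=
    (hqc.comp (by fun_prop : Continuous fun p : ℝ × ℝ => (p.1, p.1 - p.2))).sub
      (hdiag.comp continuous_fst)
  have hk2 : Continuous (Function.uncurry fun θ r =>
      Q (φ' (θ - r)) (ψ' θ) - Q (φ' θ) (ψ' θ)) :=
    (hqc.comp (by fun_prop : Continuous fun p : ℝ × ℝ => (p.1 - p.2, p.1))).sub
      (hdiag.comp continuous_fst)
  have hint1 := integrableOn_triangle_rpow_mul hα hk1 (inc1 hq) t
  have hint2 := integrableOn_triangle_rpow_mul hα hk2 (inc2 hq) t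
  have hmem : ∀ p ∈ triangle t, p.1 ∈ Icc 0 t ∧ p.1 - p.2 ∈ Icc 0 t := fun p hp =>
    ⟨⟨hp.1.le.trans hp.2.1, hp.2.2⟩, ⟨by linarith [hp.2.1], by linarith [hp.1, hp.2.2]⟩⟩
  refine ⟨?_, ?_, ?_, ?_, ?_, fun I J hI hJ => ⟨hI.1.integrable_mul hJ.1, ?_⟩⟩
  · obtain ⟨I, hI⟩ := hW.exists_isNonlinearIntegral hφc.measurable hφB ht hlim₁
    exact ⟨I, (isNonlinearIntegral_congr ht hφe).1 hI⟩
  · obtain ⟨I, hI⟩ := hW.exists_isNonlinearIntegral hψc.measurable hψB ht hlim₂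
    exact ⟨I, (isNonlinearIntegral_congr ht hψe).1 hI⟩
  · refine (intervalIntegrable_rpow_mul_continuous (p := 2 * H - 1) (by linarith)
      hdiag 0 t).congr fun θ hθ => ?_
    rw [uIoc_of_le ht] at hθ
    simp only [hφe (Ioc_subset_Icc_self hθ), hψe (Ioc_subset_Icc_self hθ)]
  · refine hint1.congr_fun (fun p hp => ?_) (measurableSet_triangle t)
    simp only [hφe (hmem p hp).1, hψe (hmem p hp).1, hψe (hmem p hp).2]
  · refine hint2.congr_fun (fun p hp => ?_) (measurableSet_triangle t)
    simp only [hφe (hmem p hp).1, hψe (hmem p hp).1, hφe (hmem p hp).2]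
  · rw [hW.integral_mul_eq hφc.measurable hψc.measurable hφB hψB ht hlim
      ((isNonlinearIntegral_congr ht hφe).2 hI) ((isNonlinearIntegral_congr ht hψe).2 hJ)]
    have hsub : ∀ θ ∈ Icc 0 t, ∀ r ∈ Icc 0 θ, θ - r ∈ Icc 0 t := fun θ hθ r hr =>
      ⟨by linarith [hr.2], by linarith [hr.1, hθ.2]⟩
    congr 1
    · congr 1
      · congr 1
        refine intervalIntegral.integral_congr fun θ hθ => ?_
        rw [uIcc_of_le ht] at hθ
        simp only [hφe hθ, hψe hθ]
      · congr 1
        refine intervalIntegral.integral_congr fun θ hθ => ?_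
        rw [uIcc_of_le ht] at hθ
        refine intervalIntegral.integral_congr fun r hr => ?_
        rw [uIcc_of_le hθ.1] at hr
        simp only [hφe hθ, hψe hθ, hψe (hsub θ hθ r hr)]
    · congr 1
      refine intervalIntegral.integral_congr fun θ hθ => ?_
      rw [uIcc_of_le ht] at hθ
      refine intervalIntegral.integral_congr fun r hr => ?_
      rw [uIcc_of_le hθ.1] at hr
      simp only [hφe hθ, hψe hθ, hφe (hsub θ hθ r hr)]
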